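/- Theorem 3.3. Let $a<b$, $B,\rho,c_0,R>0$, $k\ge 2$, $N\ge 1$ be fixed ($k,N$ integers), and put $h=1/k$, $x_i=ih$, $y_j=jh$ ($0\le i,j\le k$). Let $\Phi_0,\Phi_1,\dots$ be obtained from $\{\alpha^n e^\alpha\}_{n\ge 0}$ by Gram–Schmidt orthonormalization in $L_2(a,b)$, and let $M_N=(\int_a^b\Phi_m\Phi_n'\,d\alpha)_{m,n=0}^{N-1}$. *Spaces.* $H^{1,h}_N$ is the space of vector functions $W=W_{ij}(z)\in\mathbb R^N$ ($0\le i,j\le k$, $z\in[B,B+\rho]$) that are square integrable in $z$, with $$\|W\|^2=\sum_{i,j=1}^{k-1}\int_B^{B+\rho}\left(|\partial_xW_{ij}|^2+|\partial_yW_{ij}|^2\right)dz+\sum_{i,j=0}^{k}\int_B^{B+\rho}|W_{ij}|^2dz,$$ where $\partial_xW_{ij}=(W_{i+1,j}-W_{i-1,j})/(2h)$ and $\partial_yW_{ij}=(W_{i,j+1}-W_{i,j-1})/(2h)$ at interior nodes. For $W=(u_0,\dots,u_{N-1})^T$ put $u(\cdot,\alpha)=\sum_{n<N} u_n\Phi_n(\alpha)$;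 similarly, grid data $G=(G_{ij})$, $G_{ij}\in\mathbb R^N$, define $g_{ij}(\alpha)=\sum_{n<N} (G_{ij})_n\Phi_n(\alpha)$. Put $\|q\|_{L_2^h}^2=\sum_{i,j=0}^k\int_a^b q_{ij}(\alpha)^2d\alpha$. Let $\Gamma^h\cup D_B^h$ consist of the points $(x_i,y_j,z)$, $z\in[B,B+\rho]$, such that $i\in\{0,k\}$ or $j\in\{0,k\}$ or $z=B$ (functions are evaluated there pointwise). *Operator and functional.* Fix $s\in\{0,1\}$. At interior nodes let $P=(P_0,\dots,P_{N-1})^T$, $$P_n(W,G)=\int_a^b\Phi_n\,\partial_\alpha^s\Big[-\int_z^{B+\rho}\frac{u_x}{2\sqrt u}\,dt+g_x\Big]^2d\alpha+\int_a^b\Phi_n\,\partial_\alpha^s\Big[-\int_z^{B+\rho}\frac{u_y}{2\sqrt u}\,dt+g_y\Big]^2d\alpha ,$$ where $u_x,u_y,g_x,g_y$ are the central differences, and for $\lambda>0$ let $$J_\lambda(W)=\sum_{i,j=1}^{k-1}\int_B^{B+\rho}\big|M_NW_{ij}+P(W,G)_{ij}\big|^2e^{2\lambda z}\,dz .$$ For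 boundary data $\widetilde G$ on $\Gamma^h\cup D_B^h$ let $K(\widetilde G,R)$ be the set of all $W\in H^{1,h}_N$ with $u\ge c_0^2$ at all nodes, for all $z\in[B,B+\rho]$ and $\alpha\in[a,b]$, with $W=\widetilde G$ on $\Gamma^h\cup D_B^h$ and with $\|W\|<R$; $\overline{K}$ is its closure in $H^{1,h}_N$. *Claim.* For all $\lambda>0$ and $\gamma\in\mathbb R$ there is a constant $C>0$, depending only on $a,b,B,\rho,c_0,R,k,N,s,\gamma,\lambda$, with the following property. Let $\delta\in(0,1)$; let $(G,\widetilde G)$ be noisy data with $\|g\|_{L_2^h}\le\gamma$ and $(G^*,\widetilde G^*)$ noiseless data with exact solution $W^*\in K(\widetilde G^*,R)$, that is, $M_NW^*+P(W^*,G^*)=0$ at all interior nodes for all $z\in(B,B+\rho)$. Assume $$\|g-g^*\|_{L_2^h}+\|\partial_\alpha(g-g^*)\|_{L_2^h}<\delta ,$$ and that there are $F,F^*\in H^{1,h}_N$ with $F=\widetilde G$ and $F^*=\widetilde G^*$ on $\Gamma^h\cup D_B^h$, $\|F-F^*\|<\delta$, $\|F\|<R$, $\|F^*\|<R$. Assume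 finally that $\|W^*\|<R-\kappa$ for some $\kappa\in(0,R)$ with $C\delta<\kappa$. Then every minimizer $W_{\min}$ of $J_\lambda$ (formed with $G$) on $\overline{K(\widetilde G,R)}$ satisfies $$\|W_{\min}-W^*\|\le C\delta .$$ -/

import Mathlib

noncomputable section

namespace TravelTime

open scoped BigOperators

/-- The functions `q_n(α) = α ^ n * e ^ α`. -/
def expMonomial (n : ℕ) (α : ℝ) : ℝ := α ^ n * Real.exp α

/-- Scalar product of `L_2(a, b)`. -/
def ip (a b : ℝ) (f g : ℝ → ℝ) : ℝ := ∫ α in a..b, f α * g α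

/-- Gram-Schmidt orthogonalization of `q_0, q_1, ...` in `L_2(a, b)` (before normalization). -/
def gramSchmidtFun (a b : ℝ) (n : ℕ) : ℝ → ℝ := fun α =>
  expMonomial n α -
    ∑ i : Fin n, (ip a b (gramSchmidtFun a b i) (expMonomial n) /
      ip a b (gramSchmidtFun a b i) (gramSchmidtFun a b i)) * gramSchmidtFun a b i α
termination_by n
decreasing_by all_goals exact i.2

/-- The orthonormal basis functions `Φ_n` of `L_2(a, b)`. -/
def phi (a b : ℝ) (n : ℕ) (α : ℝ) : ℝ :=
  gramSchmidtFun a b n α / √(ip a b (gramSchmidtFun a b n) (gramSchmidtFun a b n))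

/-- The `N × N` matrix `M_N` with entries `⟨Φ_m, Φ_n'⟩`. -/
def matM (a b : ℝ) (N : ℕ) : Matrix (Fin N) (Fin N) ℝ :=
  Matrix.of fun m n => ip a b (phi a b m) (deriv (phi a b n))

/-- The function `α ↦ ∑_{n < N} w_n Φ_n(α)` with coefficient vector `w`. -/
def series (a b : ℝ) {N : ℕ} (w : EuclideanSpace ℝ (Fin N)) (α : ℝ) : ℝ :=
  ∑ n : Fin N, w n * phi a b n α

/-- The square grid has the nodes `(i / k, j / k)`, `0 ≤ i, j ≤ k`, and the step `h = 1 / k`. Its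
interior nodes `1, ..., k - 1` in one direction are indexed by `Fin (k - 1)`; `mid i` is the
node number `i + 1`, and `lft i`, `rgt i` are its two neighbours. -/
def lft {k : ℕ} (i : Fin (k - 1)) : Fin (k + 1) := ⟨i, by omega⟩

/-- See `lft`. -/
def mid {k : ℕ} (i : Fin (k - 1)) : Fin (k + 1) := ⟨i + 1, by omega⟩

/-- See `lft`. -/
def rgt {k : ℕ} (i : Fin (k - 1)) : Fin (k + 1) := ⟨i + 2, by omega⟩

/-- The node index is an end point of its grid line. -/
def IsEnd {k : ℕ} (i : Fin (k + 1)) : Prop := i = 0 ∨ i = Fin.last k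

/-- Central difference in `x`, at the interior nodes, of a grid function with values in `V`;
`V` is a space of vectors or a space of functions of `z`. -/
def dx {k : ℕ} {V : Type*} [AddCommGroup V] [Module ℝ V]
    (Q : Fin (k + 1) → Fin (k + 1) → V) (i j : Fin (k - 1)) : V :=
  (2 * (1 / (k : ℝ)))⁻¹ • (Q (rgt i) (mid j) - Q (lft i) (mid j))

/-- Central difference in `y`, at the interior nodes. -/
def dy {k : ℕ} {V : Type*} [AddCommGroup V] [Module ℝ V]
    (Q : Fin (k + 1) → Fin (k + 1) → V) (i j : Fin (k - 1)) : V :=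
  (2 * (1 / (k : ℝ)))⁻¹ • (Q (mid i) (rgt j) - Q (mid i) (lft j))

/-- Semidiscrete `N`-dimensional vector functions `W(x_i, y_j, z)`: discrete in `x, y`,
continuous variable `z` (only `z ∈ [B, B + ρ]` is ever used). -/
abbrev SemiFun (k N : ℕ) : Type :=
  Fin (k + 1) → Fin (k + 1) → ℝ → EuclideanSpace ℝ (Fin N)

/-- Sum over a finite square array of nodes of the squared `L_2(B, B + ρ)` norms. -/
def l2Sq (B ρ : ℝ) {m N : ℕ} (Q : Fin m → Fin m → ℝ → EuclideanSpace ℝ (Fin N)) : ℝ :=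
  ∑ i : Fin m, ∑ j : Fin m, ∫ z in B..(B + ρ), ‖Q i j z‖ ^ 2

/-- Membership in `H_N^{1,h}(Ω^h)`: every component is square integrable in `z ∈ (B, B + ρ)`
(the finite differences are then square integrable as well). -/
def MemH1 (B ρ : ℝ) {k N : ℕ} (W : SemiFun k N) : Prop :=
  ∀ i j, MeasureTheory.MemLp (W i j) 2
    (MeasureTheory.volume.restrict (Set.Ioo B (B + ρ)))

/-- The norm of `H_N^{1,h}(Ω^h)`. -/
def normH1 (B ρ : ℝ) {k N : ℕ} (W : SemiFun k N) : ℝ :=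
  √(l2Sq B ρ (dx W) + l2Sq B ρ (dy W) + l2Sq B ρ W)

/-- The norm of `L_2^h(Ω_1^h × (a, b))`, for functions of a grid node and of `α`. -/
def normGrid (a b : ℝ) {k : ℕ} (q : Fin (k + 1) → Fin (k + 1) → ℝ → ℝ) : ℝ :=
  √(∑ i : Fin (k + 1), ∑ j : Fin (k + 1), ∫ α in a..b, (q i j α) ^ 2)

/-- `W` and `Gt` agree on `Γ^h ∪ D_B^h`: on the lateral boundary nodes for all
`z ∈ [B, B + ρ]`, and at all nodes for `z = B`. -/
def AgreeOnBoundary (B ρ : ℝ) {k N : ℕ} (W Gt : SemiFun k N) : Prop :=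
  ∀ i j, ∀ z ∈ Set.Icc B (B + ρ), (IsEnd i ∨ IsEnd j ∨ z = B) → W i j z = Gt i j z

/-- The set `K^h(R)` with the boundary data `Gt`. -/
def setK (a b B ρ c₀ : ℝ) {k N : ℕ} (Gt : SemiFun k N) (R : ℝ) : Set (SemiFun k N) :=
  {W | MemH1 B ρ W ∧
    (∀ i j, ∀ z ∈ Set.Icc B (B + ρ), ∀ α ∈ Set.Icc a b, c₀ ^ 2 ≤ series a b (W i j z) α) ∧
    AgreeOnBoundary B ρ W Gt ∧ normH1 B ρ W < R}

/-- Closure of a set in the space `H_N^{1,h}(Ω^h)`. -/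
def closureH1 (B ρ : ℝ) {k N : ℕ} (S : Set (SemiFun k N)) : Set (SemiFun k N) :=
  {W | MemH1 B ρ W ∧ ∀ ε > 0, ∃ V ∈ S, normH1 B ρ (W - V) < ε}

/-- The bracket `-∫_z^{B+ρ} u_x / (2 √u) dt + g_x` (or the same with `y`) at one node: `w` is the
vector of coefficients of `u`, `d` that of its difference, `p` that of the difference of `g`. -/
def bracket (a b B ρ : ℝ) {N : ℕ} (w d : ℝ → EuclideanSpace ℝ (Fin N))
    (p : EuclideanSpace ℝ (Fin N)) (z α : ℝ) : ℝ :=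
  -(∫ t in z..(B + ρ), series a b (d t) α / (2 * √(series a b (w t) α))) + series a b p α

/-- The component `P_n` at the interior node `(i, j)`, with `s` derivatives in `α` of the squared
brackets (`s = 0` or `s = 1`). -/
def opP (s : ℕ) (a b B ρ : ℝ) {k N : ℕ}
    (G : Fin (k + 1) → Fin (k + 1) → EuclideanSpace ℝ (Fin N)) (W : SemiFun k N)
    (n : Fin N) (i j : Fin (k - 1)) (z : ℝ) : ℝ :=
  (∫ α in a..b, phi a b n α * iteratedDeriv s
      (fun β => (bracket a b B ρ (W (mid i) (mid j)) (dx W i j) (dx G i j) z β) ^ 2) α) +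
  ∫ α in a..b, phi a b n α * iteratedDeriv s
      (fun β => (bracket a b B ρ (W (mid i) (mid j)) (dy W i j) (dy G i j) z β) ^ 2) α

/-- The vector `M_N W + P` at the interior node `(i, j)` and at `z`. -/
def residual (s : ℕ) (a b B ρ : ℝ) {k N : ℕ}
    (G : Fin (k + 1) → Fin (k + 1) → EuclideanSpace ℝ (Fin N)) (W : SemiFun k N)
    (i j : Fin (k - 1)) (z : ℝ) : EuclideanSpace ℝ (Fin N) :=
  WithLp.toLp 2 fun n =>
    (∑ m : Fin N, matM a b N n m * W (mid i) (mid j) z m) + opP s a b B ρ G W n i j z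

/-- The Carleman weighted functional `J_λ`. -/
def costJ (s : ℕ) (a b B ρ lam : ℝ) {k N : ℕ}
    (G : Fin (k + 1) → Fin (k + 1) → EuclideanSpace ℝ (Fin N)) (W : SemiFun k N) : ℝ :=
  l2Sq B ρ fun i j z => Real.exp (lam * z) • residual s a b B ρ G W i j z

end TravelTime

end

/-! ### Gram–Schmidt with polynomial factors, and the matrix `matM`. -/

noncomputable section

namespace TravelTime

open Polynomial

/-! The constant may depend on `λ`, so neither convexity of the functional nor a large Carleman
weight is needed. The proof combines a stability estimate for a Volterra system in `z` with one
well-chosen competitor for the minimizer.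

Stability. Write `Φ_n = p_n e^α` with `deg p_n = n`. Then `Φ_n' = Φ_n + p_n' e^α`, and the last term
is orthogonal to `Φ_m` for `m ≥ n`. So `M_N` is upper triangular with unit diagonal, and `|w| ≤ K
|M_N w|` (`exists_norm_le_matM`). The operator `P` at level `z` sees `W` only on `(z, B + ρ)`, and
the square of its increment is at most a constant times `∫_z^{B+ρ} |W₁ - W₂|² + |G₁ - G₂|²`
(`exists_sq_opP_sub_le`). Here `u ≥ c₀²` makes the quotient Lipschitz, Cauchy–Schwarz and the norm
bound control the product terms, and for `s = 1` the derivative in `α` is moved to `Φ_n` by parts.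
Subtracting the equation of `W*` from the residual of `W` and inverting `M_N` bounds `|W - W*|²(z)`
at interior nodes by the squared residual, the data error and `∫_z^{B+ρ} |W - W*|²`; at lateral
nodes `W - W* = F - F*`. Backward Gronwall (`integral_le_of_ae_le_add_integral`) closes the estimate
in `L_2` (`exists_integral_gridSq_sub_le`). On a fixed grid, finite differences are bounded by nodal
values, so `L_2` controls the full norm (`MemH1.normH1_sq_le`).

Competitor. Let `V` equal `F` on the boundary and `W*` elsewhere (`glue`). The margin `κ` keeps its
norm below `R`, so `V` is admissible. For `z > B` it agrees with `W*` at interior nodes, so its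
residual is just an increment of `P`, of size `O(δ)`. Hence `J(W_min) ≤ J(V) = O(δ²)`. The weight is
at least `1` because `λ` and `B` are positive, so the residual of `W_min` is `O(δ)` in `L_2`, and
stability applies. -/

/-- The scalar product of `p e^α` and `q e^α` in `L_2(a, b)`, as a bilinear form in `p`, `q`. -/
def polyForm (a b : ℝ) : ℝ[X] →ₗ[ℝ] ℝ[X] →ₗ[ℝ] ℝ :=
  LinearMap.mk₂ ℝ
    (fun p q => ∫ α in a..b, (p.eval α * Real.exp α) * (q.eval α * Real.exp α))
    (fun p p' q => by
      rw [← intervalIntegral.integral_add] <;>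
        first
        | (refine Continuous.intervalIntegrable ?_ _ _; fun_prop)
        | (congr 1; ext α; simp; ring))
    (fun c p q => by
      rw [smul_eq_mul, ← intervalIntegral.integral_const_mul]
      congr 1; ext α; simp; ring)
    (fun p q q' => by
      rw [← intervalIntegral.integral_add] <;>
        first
        | (refine Continuous.intervalIntegrable ?_ _ _; fun_prop)
        | (congr 1; ext α; simp; ring))
    (fun c p q => by
      rw [smul_eq_mul, ← intervalIntegral.integral_const_mul]
      congr 1; ext α; simp; ring)

theorem polyForm_apply (a b : ℝ) (p q : ℝ[X]) :
    polyForm a b p q = ∫ α in a..b, (p.eval α * Real.exp α) * (q.eval α * Real.exp α) := rfl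

theorem polyForm_comm (a b : ℝ) (p q : ℝ[X]) : polyForm a b p q = polyForm a b q p := by
  simp only [polyForm_apply, mul_comm]

/-- A nonzero polynomial cannot vanish on the infinite set `[a, b]`. -/
theorem polyForm_self_pos {a b : ℝ} (hab : a < b) {p : ℝ[X]} (hp : p ≠ 0) :
    0 < polyForm a b p p := by
  rw [polyForm_apply]
  refine intervalIntegral.integral_pos hab (by fun_prop) (fun x _ => mul_self_nonneg _) ?_
  by_contra! h
  refine hp (Polynomial.eq_zero_of_infinite_isRoot p ((Set.Icc_infinite hab).mono fun x hx => ?_))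
  have h0 := le_antisymm (h x hx) (mul_self_nonneg _)
  simpa [(Real.exp_pos x).ne'] using h0

/-- The polynomial factor of `gramSchmidtFun`. -/
def gsPoly (a b : ℝ) (n : ℕ) : ℝ[X] :=
  X ^ n - ∑ i : Fin n, (polyForm a b (gsPoly a b i) (X ^ n) /
    polyForm a b (gsPoly a b i) (gsPoly a b i)) • gsPoly a b i
termination_by n
decreasing_by all_goals exact i.2

theorem gramSchmidtFun_eq (a b : ℝ) (n : ℕ) :
    gramSchmidtFun a b n = fun α => (gsPoly a b n).eval α * Real.exp α := by
  induction n using Nat.strong_induction_on with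
  | _ n ih =>
    funext α
    rw [gramSchmidtFun, gsPoly]
    have h1 : ∀ i : Fin n, gramSchmidtFun a b i =
        fun α => (gsPoly a b i).eval α * Real.exp α := fun i => ih i i.2
    simp only [h1, eval_sub, eval_finsetSum, eval_smul, eval_pow, eval_X, sub_mul,
      Finset.sum_mul, expMonomial, smul_eq_mul, mul_assoc]
    congr 1
    refine Finset.sum_congr rfl fun i _ => ?_
    simp [ip, polyForm_apply, expMonomial]

theorem degree_gsPoly (a b : ℝ) (n : ℕ) : (gsPoly a b n).degree = n := by
  induction n using Nat.strong_induction_on with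
  | _ n ih =>
    rw [gsPoly, degree_sub_eq_left_of_degree_lt, degree_X_pow]
    rw [degree_X_pow, ← mem_degreeLT]
    refine Submodule.sum_mem _ fun i _ => Submodule.smul_mem _ _ ?_
    rw [mem_degreeLT, ih i i.2]
    exact_mod_cast i.2

theorem gsPoly_ne_zero (a b : ℝ) (n : ℕ) : gsPoly a b n ≠ 0 := by
  intro h
  simpa [h] using degree_gsPoly a b n

/-- By strong induction all earlier pairs are orthogonal, so only the `m`-th projection survives in
the sum, and it cancels the `X ^ n` term. -/
theorem polyForm_gsPoly_of_lt {a b : ℝ} (hab : a < b) (n : ℕ) :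
    ∀ m < n, polyForm a b (gsPoly a b m) (gsPoly a b n) = 0 := by
  induction n using Nat.strong_induction_on with
  | _ n ih =>
    intro m hm
    rw [gsPoly.eq_1 a b n, map_sub, map_sum, Finset.sum_eq_single (⟨m, hm⟩ : Fin n)]
    · rw [map_smul, smul_eq_mul, div_mul_cancel₀ _ (polyForm_self_pos hab (gsPoly_ne_zero a b m)).ne',
        sub_self]
    · intro i _ hi
      rw [map_smul, smul_eq_mul]
      rcases lt_trichotomy (i : ℕ) m with h | h | h
      · rw [polyForm_comm a b (gsPoly a b m), ih m hm i h, mul_zero]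
      · exact absurd (Fin.ext h) hi
      · rw [ih i i.2 m h, mul_zero]
    · simp

theorem polyForm_gsPoly_of_ne {a b : ℝ} (hab : a < b) {m n : ℕ} (h : m ≠ n) :
    polyForm a b (gsPoly a b m) (gsPoly a b n) = 0 := by
  rcases lt_or_gt_of_ne h with h | h
  · exact polyForm_gsPoly_of_lt hab n m h
  · rw [polyForm_comm, polyForm_gsPoly_of_lt hab m n h]

/-- Since `gsPoly a b d` has exact degree `d`, subtracting a multiple of it removes the top
coefficient of `p`; the multiple itself is orthogonal because `d < n`. -/
theorem polyForm_gsPoly_of_degree_lt {a b : ℝ} (hab : a < b) {n : ℕ} (d : ℕ) (hd : d ≤ n) :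
    ∀ p : ℝ[X], p.degree < d → polyForm a b (gsPoly a b n) p = 0 := by
  induction d with
  | zero =>
    intro p hp
    have : p = 0 := by simpa using hp
    simp [this]
  | succ d ih =>
    intro p hp
    have hlead : (gsPoly a b d).coeff d ≠ 0 := by
      have := leadingCoeff_ne_zero.2 (gsPoly_ne_zero a b d)
      rwa [leadingCoeff, natDegree_eq_of_degree_eq_some (degree_gsPoly a b d)] at this
    set c := p.coeff d / (gsPoly a b d).coeff d with hc
    have hq : (p - c • gsPoly a b d).degree < d := by
      rw [degree_lt_iff_coeff_zero]
      intro m hm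
      rcases hm.eq_or_lt with rfl | hm
      · simp [hc, hlead]
      · rw [coeff_sub, coeff_smul, (degree_lt_iff_coeff_zero p (d + 1)).1 hp m hm,
          coeff_eq_zero_of_degree_lt (by rw [degree_gsPoly]; exact_mod_cast hm)]
        simp
    have := ih (by omega) _ hq
    rwa [map_sub, map_smul, polyForm_gsPoly_of_ne hab (by omega), smul_zero, sub_zero] at this

/-- The norm of the `n`-th Gram-Schmidt vector. -/
def gsNorm (a b : ℝ) (n : ℕ) : ℝ := √(polyForm a b (gsPoly a b n) (gsPoly a b n))

theorem gsNorm_pos {a b : ℝ} (hab : a < b) (n : ℕ) : 0 < gsNorm a b n :=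
  Real.sqrt_pos.2 (polyForm_self_pos hab (gsPoly_ne_zero a b n))

theorem gsNorm_mul_self {a b : ℝ} (hab : a < b) (n : ℕ) :
    gsNorm a b n * gsNorm a b n = polyForm a b (gsPoly a b n) (gsPoly a b n) :=
  Real.mul_self_sqrt (polyForm_self_pos hab (gsPoly_ne_zero a b n)).le

/-- The polynomial factor of `phi`. -/
def phiPoly (a b : ℝ) (n : ℕ) : ℝ[X] := (gsNorm a b n)⁻¹ • gsPoly a b n

theorem phi_eq (a b : ℝ) (n : ℕ) :
    phi a b n = fun α => (phiPoly a b n).eval α * Real.exp α := by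
  funext α
  simp only [phi, gramSchmidtFun_eq, phiPoly, gsNorm, polyForm_apply, ip, eval_smul, smul_eq_mul]
  ring

theorem hasDerivAt_phi (a b : ℝ) (n : ℕ) (α : ℝ) :
    HasDerivAt (phi a b n)
      ((phiPoly a b n + derivative (phiPoly a b n)).eval α * Real.exp α) α := by
  rw [phi_eq]
  refine (((phiPoly a b n).hasDerivAt α).mul (Real.hasDerivAt_exp α)).congr_deriv ?_
  simp only [eval_add]; ring

theorem deriv_phi (a b : ℝ) (n : ℕ) : deriv (phi a b n) = fun α =>
    (phiPoly a b n + derivative (phiPoly a b n)).eval α * Real.exp α :=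
  funext fun α => (hasDerivAt_phi a b n α).deriv

theorem continuous_phi (a b : ℝ) (n : ℕ) : Continuous (phi a b n) := by
  rw [phi_eq]; fun_prop

theorem continuous_deriv_phi (a b : ℝ) (n : ℕ) : Continuous (deriv (phi a b n)) := by
  rw [deriv_phi]; fun_prop

theorem ip_phi {a b : ℝ} (hab : a < b) (m n : ℕ) :
    ip a b (phi a b m) (phi a b n) = if m = n then 1 else 0 := by
  have h : ip a b (phi a b m) (phi a b n) = polyForm a b (phiPoly a b m) (phiPoly a b n) := by
    simp only [ip, phi_eq, polyForm_apply]
  rw [h]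
  simp only [phiPoly, map_smul, LinearMap.smul_apply, smul_eq_mul]
  split_ifs with hmn
  · subst hmn
    rw [← gsNorm_mul_self hab]
    have := (gsNorm_pos hab m).ne'
    field_simp
  · rw [polyForm_gsPoly_of_ne hab hmn]; simp

/-- Differentiating `p e^α` gives `p e^α` plus a term whose polynomial has smaller degree, and that
term is orthogonal to `Φ_m`. -/
theorem ip_phi_deriv_phi {a b : ℝ} (hab : a < b) {m n : ℕ} (hmn : n ≤ m) :
    ip a b (phi a b m) (deriv (phi a b n)) = if m = n then 1 else 0 := by
  have hd : (derivative (gsPoly a b n)).degree < (n : WithBot ℕ) := by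
    have := degree_derivative_lt (gsPoly_ne_zero a b n)
    rwa [degree_gsPoly] at this
  have h : ip a b (phi a b m) (deriv (phi a b n)) = ip a b (phi a b m) (phi a b n) +
      polyForm a b (phiPoly a b m) (derivative (phiPoly a b n)) := by
    have : ip a b (phi a b m) (phi a b n) = polyForm a b (phiPoly a b m) (phiPoly a b n) := by
      simp only [ip, phi_eq, polyForm_apply]
    rw [this, ← map_add]
    simp only [ip, deriv_phi, polyForm_apply]
    simp only [phi_eq]
  rw [h, ip_phi hab]
  simp only [phiPoly, map_smul, LinearMap.smul_apply]
  rw [polyForm_gsPoly_of_degree_lt hab m le_rfl _ (hd.trans_le (by exact_mod_cast hmn))]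
  simp

theorem det_matM {a b : ℝ} (hab : a < b) (N : ℕ) : (matM a b N).det = 1 := by
  rw [Matrix.det_of_isUpperTriangular]
  · refine Finset.prod_eq_one fun i _ => ?_
    simp [matM, ip_phi_deriv_phi hab le_rfl]
  · intro m n hmn
    have hmn' : (n : ℕ) < m := hmn
    simp [matM, ip_phi_deriv_phi hab hmn'.le, hmn'.ne']

/-- An injective linear map between finite-dimensional spaces is bounded below; injectivity comes
from the determinant `1`. -/
theorem exists_norm_le_matM {a b : ℝ} (hab : a < b) (N : ℕ) :
    ∃ K > 0, ∀ w : EuclideanSpace ℝ (Fin N),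
      ‖w‖ ≤ K * ‖WithLp.toLp 2 fun n => ∑ m : Fin N, matM a b N n m * w m‖ := by
  have hdet : IsUnit (matM a b N) := by
    rw [Matrix.isUnit_iff_isUnit_det, det_matM hab]; exact isUnit_one
  have hinj : LinearMap.ker (Matrix.toEuclideanLin (matM a b N)) = ⊥ := by
    rw [LinearMap.ker_eq_bot]
    intro v w hvw
    have h := Matrix.mulVec_injective_iff_isUnit.2 hdet
    have := congrArg WithLp.ofLp hvw
    simp only [Matrix.toLpLin_apply] at this
    exact WithLp.ofLp_injective 2 (h this)
  obtain ⟨K, hK, hL⟩ := LinearMap.exists_antilipschitzWith _ hinj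
  refine ⟨K, hK, fun w => ?_⟩
  have := hL.le_mul_dist w 0
  simp only [map_zero, dist_zero_right] at this
  exact this

/-! ### Series in the basis: Parseval identity and uniform bounds on `[a, b]`. -/

/-- The `α`-derivative of `series`. -/
def seriesDeriv (a b : ℝ) {N : ℕ} (w : EuclideanSpace ℝ (Fin N)) (α : ℝ) : ℝ :=
  ∑ n : Fin N, w n * deriv (phi a b n) α

theorem hasDerivAt_series (a b : ℝ) {N : ℕ} (w : EuclideanSpace ℝ (Fin N)) (α : ℝ) :
    HasDerivAt (series a b w) (seriesDeriv a b w α) α := by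
  unfold series seriesDeriv
  refine HasDerivAt.fun_sum fun n _ => HasDerivAt.const_mul _ ?_
  rw [deriv_phi]
  exact hasDerivAt_phi a b n α

theorem continuous_series_left (a b : ℝ) {N : ℕ} (α : ℝ) :
    Continuous fun w : EuclideanSpace ℝ (Fin N) => series a b w α := by
  unfold series; fun_prop

theorem continuous_seriesDeriv_left (a b : ℝ) {N : ℕ} (α : ℝ) :
    Continuous fun w : EuclideanSpace ℝ (Fin N) => seriesDeriv a b w α := by
  unfold seriesDeriv; fun_prop

theorem continuous_series (a b : ℝ) {N : ℕ} (w : EuclideanSpace ℝ (Fin N)) :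
    Continuous (series a b w) := by
  unfold series
  have := continuous_phi a b
  fun_prop

theorem series_sub (a b : ℝ) {N : ℕ} (v w : EuclideanSpace ℝ (Fin N)) (α : ℝ) :
    series a b (v - w) α = series a b v α - series a b w α := by
  simp [series, sub_mul]

theorem integral_series_sq {a b : ℝ} (hab : a < b) {N : ℕ} (w : EuclideanSpace ℝ (Fin N)) :
    ∫ α in a..b, series a b w α ^ 2 = ‖w‖ ^ 2 := by
  have h1 : ∀ α, series a b w α ^ 2 =
      ∑ m : Fin N, ∑ n : Fin N, w m * w n * (phi a b m α * phi a b n α) := by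
    intro α
    rw [series, sq, Finset.sum_mul_sum]
    exact Finset.sum_congr rfl fun m _ => Finset.sum_congr rfl fun n _ => by ring
  have hc := continuous_phi a b
  simp only [h1]
  rw [intervalIntegral.integral_finsetSum fun m _ => Continuous.intervalIntegrable
    (by fun_prop) _ _, EuclideanSpace.real_norm_sq_eq]
  refine Finset.sum_congr rfl fun m _ => ?_
  rw [intervalIntegral.integral_finsetSum fun n _ => Continuous.intervalIntegrable
    (by fun_prop) _ _]
  have h2 : ∀ n : Fin N, ∫ α in a..b, w m * w n * (phi a b m α * phi a b n α) =
      if m = n then w m * w n else 0 := by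
    intro n
    rw [intervalIntegral.integral_const_mul]
    have := ip_phi hab m n
    rw [ip] at this
    rw [this]
    simp [Fin.ext_iff]
  simp [h2, sq]

/-- `S` bounds the basis functions, the series, and their `α`-derivatives on `[a, b]`. -/
structure SeriesBound (a b : ℝ) (N : ℕ) (S : ℝ) : Prop where
  pos : 0 < S
  series : ∀ (w : EuclideanSpace ℝ (Fin N)), ∀ α ∈ Set.Icc a b, |series a b w α| ≤ S * ‖w‖
  seriesDeriv : ∀ (w : EuclideanSpace ℝ (Fin N)), ∀ α ∈ Set.Icc a b,
    |seriesDeriv a b w α| ≤ S * ‖w‖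
  phi : ∀ n : Fin N, ∀ α ∈ Set.Icc a b, |phi a b n α| ≤ S
  deriv_phi : ∀ n : Fin N, ∀ α ∈ Set.Icc a b, |deriv (TravelTime.phi a b n) α| ≤ S

theorem exists_seriesBound (a b : ℝ) (N : ℕ) : ∃ S, SeriesBound a b N S := by
  have h1 : ∀ n : ℕ, ∃ S, ∀ α ∈ Set.Icc a b, |phi a b n α| ≤ S := fun n =>
    isCompact_Icc.exists_bound_of_continuousOn (continuous_phi a b n).continuousOn
  have h2 : ∀ n : ℕ, ∃ S, ∀ α ∈ Set.Icc a b, |deriv (phi a b n) α| ≤ S := fun n =>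
    isCompact_Icc.exists_bound_of_continuousOn (continuous_deriv_phi a b n).continuousOn
  choose S hS using h1
  choose S' hS' using h2
  set T := ∑ n : Fin N, (|S n| + |S' n|) with hT
  have hle : ∀ n : Fin N, |S n| + |S' n| ≤ T := fun n =>
    Finset.single_le_sum (f := fun n : Fin N => |S n| + |S' n|) (fun i _ => by positivity)
      (Finset.mem_univ n)
  have hT0 : 0 ≤ T := Finset.sum_nonneg fun i _ => by positivity
  have key : ∀ (f : ℕ → ℝ) (c : Fin N → ℝ) (w : EuclideanSpace ℝ (Fin N)),
      (∀ n : Fin N, |f n| ≤ c n) → |∑ n : Fin N, w n * f n| ≤ (∑ n, c n) * ‖w‖ := by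
    intro f c w hf
    rw [Finset.sum_mul]
    refine (Finset.abs_sum_le_sum_abs _ _).trans (Finset.sum_le_sum fun n _ => ?_)
    rw [abs_mul, mul_comm]
    exact mul_le_mul (hf n) (PiLp.norm_apply_le w n) (abs_nonneg _) ((abs_nonneg _).trans (hf n))
  refine ⟨T + 1, by positivity, fun w α hα => ?_, fun w α hα => ?_, fun n α hα => ?_,
    fun n α hα => ?_⟩
  · refine (key (fun n => phi a b n α) (fun n => |S n| + |S' n|) w fun n => ?_).trans
      (mul_le_mul_of_nonneg_right (by linarith) (norm_nonneg _))
    linarith [hS n α hα, le_abs_self (S n), abs_nonneg (S' n)]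
  · refine (key (fun n => deriv (phi a b n) α) (fun n => |S n| + |S' n|) w fun n => ?_).trans
      (mul_le_mul_of_nonneg_right (by linarith) (norm_nonneg _))
    linarith [hS' n α hα, le_abs_self (S' n), abs_nonneg (S n)]
  · linarith [hS n α hα, le_abs_self (S n), abs_nonneg (S' n), hle n]
  · linarith [hS' n α hα, le_abs_self (S' n), abs_nonneg (S n), hle n]

end TravelTime

end

/-! ### Estimates of the bracket at one node. -/

noncomputable section

namespace TravelTime

open MeasureTheory Set

theorem sq_integral_mul_le {X : Type*} [MeasurableSpace X] {μ : Measure X} {f g : X → ℝ}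
    (hf0 : ∀ x, 0 ≤ f x) (hg0 : ∀ x, 0 ≤ g x) (hf : MemLp f 2 μ) (hg : MemLp g 2 μ) :
    (∫ x, f x * g x ∂μ) ^ 2 ≤ (∫ x, f x ^ 2 ∂μ) * ∫ x, g x ^ 2 ∂μ := by
  have h := integral_mul_le_Lp_mul_Lq_of_nonneg (μ := μ) Real.HolderConjugate.two_two
    (Filter.Eventually.of_forall hf0) (Filter.Eventually.of_forall hg0)
    (by simpa using hf) (by simpa using hg)
  simp only [Real.rpow_ofNat, ← Real.sqrt_eq_rpow] at h
  have h0 : 0 ≤ ∫ x, f x * g x ∂μ := integral_nonneg fun x => mul_nonneg (hf0 x) (hg0 x)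
  calc (∫ x, f x * g x ∂μ) ^ 2 ≤ (√(∫ x, f x ^ 2 ∂μ) * √(∫ x, g x ^ 2 ∂μ)) ^ 2 :=
        pow_le_pow_left₀ h0 h 2
    _ = _ := by
        rw [mul_pow, Real.sq_sqrt (integral_nonneg fun x => sq_nonneg _),
          Real.sq_sqrt (integral_nonneg fun x => sq_nonneg _)]

theorem abs_integral_le_of_norm_le {X : Type*} [MeasurableSpace X] {μ : Measure X} {f g : X → ℝ}
    (hg : Integrable g μ) (h : ∀ᵐ x ∂μ, ‖f x‖ ≤ g x) : |∫ x, f x ∂μ| ≤ ∫ x, g x ∂μ :=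
  norm_integral_le_of_norm_le hg h

theorem abs_div_two_sqrt_le {c x y : ℝ} (hc : 0 < c) (hy : c ^ 2 ≤ y) :
    |x / (2 * √y)| ≤ |x| / (2 * c) := by
  have hs : c ≤ √y := Real.le_sqrt_of_sq_le hy
  have hs0 : 0 < √y := hc.trans_le hs
  rw [abs_div, abs_of_pos (by positivity : (0 : ℝ) < 2 * √y)]
  gcongr

/-- The identity `y₁ - y₂ = (√y₁ - √y₂)(√y₁ + √y₂)` and the lower bound `c` for both roots give the
cubic denominator. Only the second numerator multiplies `|y₁ - y₂|`. -/
theorem abs_div_two_sqrt_sub_le {c x₁ x₂ y₁ y₂ : ℝ} (hc : 0 < c) (h₁ : c ^ 2 ≤ y₁)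
    (h₂ : c ^ 2 ≤ y₂) :
    |x₁ / (2 * √y₁) - x₂ / (2 * √y₂)| ≤
      |x₁ - x₂| / (2 * c) + |x₂| * |y₁ - y₂| / (4 * c ^ 3) := by
  have hs₁ : c ≤ √y₁ := Real.le_sqrt_of_sq_le h₁
  have hs₂ : c ≤ √y₂ := Real.le_sqrt_of_sq_le h₂
  have hp₁ : 0 < √y₁ := hc.trans_le hs₁
  have hp₂ : 0 < √y₂ := hc.trans_le hs₂
  have e₁ : √y₁ ^ 2 = y₁ := Real.sq_sqrt ((sq_nonneg c).trans h₁)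
  have e₂ : √y₂ ^ 2 = y₂ := Real.sq_sqrt ((sq_nonneg c).trans h₂)
  have key : x₁ / (2 * √y₁) - x₂ / (2 * √y₂) = (x₁ - x₂) / (2 * √y₁) -
      x₂ * (y₁ - y₂) / (2 * √y₁ * √y₂ * (√y₁ + √y₂)) := by
    have : y₁ - y₂ = (√y₁ - √y₂) * (√y₁ + √y₂) := by rw [← e₁, ← e₂]; simp; ring
    rw [this]
    field_simp
    ring
  rw [key]
  refine (abs_sub _ _).trans (add_le_add ?_ ?_)
  · exact abs_div_two_sqrt_le hc h₁
  · rw [abs_div, abs_mul, abs_of_pos (by positivity : 0 < 2 * √y₁ * √y₂ * (√y₁ + √y₂))]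
    have h4 : 4 * c ^ 3 ≤ 2 * √y₁ * √y₂ * (√y₁ + √y₂) :=
      calc 4 * c ^ 3 = 2 * c * c * (c + c) := by ring
        _ ≤ _ := by gcongr
    exact div_le_div_of_nonneg_left (by positivity) (by positivity) h4

/-- The coefficient vectors `w` of `u` and `d` of a difference of `u` are square integrable, and
`u ≥ c₀²` for almost all arguments. -/
structure Admissible (a b B ρ c₀ : ℝ) {N : ℕ} (w d : ℝ → EuclideanSpace ℝ (Fin N)) : Prop where
  memLp_left : MemLp w 2 (volume.restrict (Ioc B (B + ρ)))
  memLp_right : MemLp d 2 (volume.restrict (Ioc B (B + ρ)))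
  le_series : ∀ᵐ t ∂volume.restrict (Ioc B (B + ρ)), ∀ α ∈ Icc a b, c₀ ^ 2 ≤ series a b (w t) α

namespace Admissible

variable {a b B ρ c₀ S : ℝ} {N : ℕ} {w d w₁ d₁ w₂ d₂ : ℝ → EuclideanSpace ℝ (Fin N)}

theorem mono (h : Admissible a b B ρ c₀ w d) {z : ℝ} (hz : B ≤ z) :
    MemLp w 2 (volume.restrict (Ioc z (B + ρ))) ∧ MemLp d 2 (volume.restrict (Ioc z (B + ρ))) ∧
      ∀ᵐ t ∂volume.restrict (Ioc z (B + ρ)), ∀ α ∈ Icc a b, c₀ ^ 2 ≤ series a b (w t) α := by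
  have hμ : volume.restrict (Ioc z (B + ρ)) ≤ volume.restrict (Ioc B (B + ρ)) :=
    Measure.restrict_mono (Ioc_subset_Ioc_left hz) le_rfl
  exact ⟨h.1.mono_measure hμ, h.2.mono_measure hμ, ae_mono hμ h.3⟩

theorem aestronglyMeasurable (h : Admissible a b B ρ c₀ w d) {z : ℝ} (hz : B ≤ z) (α : ℝ) :
    AEStronglyMeasurable (fun t => series a b (d t) α / (2 * √(series a b (w t) α)))
      (volume.restrict (Ioc z (B + ρ))) := by
  obtain ⟨hw, hd, -⟩ := h.mono hz
  have h1 := ((continuous_series_left a b α).comp_aestronglyMeasurable hd.1).aemeasurable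
  have h2 := ((continuous_series_left a b α).comp_aestronglyMeasurable hw.1).aemeasurable
  exact (h1.div (h2.sqrt.const_mul 2)).aestronglyMeasurable

theorem norm_quotient_le (hS : SeriesBound a b N S) (hc₀ : 0 < c₀)
    {x y : EuclideanSpace ℝ (Fin N)} {α : ℝ} (hα : α ∈ Icc a b)
    (hy : c₀ ^ 2 ≤ series a b y α) :
    ‖series a b x α / (2 * √(series a b y α))‖ ≤ S / (2 * c₀) * ‖x‖ := by
  refine (abs_div_two_sqrt_le hc₀ hy).trans ?_
  rw [div_mul_eq_mul_div]
  gcongr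
  exact hS.series x α hα

theorem integrable_quotient (h : Admissible a b B ρ c₀ w d) (hS : SeriesBound a b N S)
    (hc₀ : 0 < c₀) {z : ℝ} (hz : B ≤ z) {α : ℝ} (hα : α ∈ Icc a b) :
    Integrable (fun t => series a b (d t) α / (2 * √(series a b (w t) α)))
      (volume.restrict (Ioc z (B + ρ))) := by
  obtain ⟨hw, hd, hp⟩ := h.mono hz
  refine Integrable.mono' ((hd.integrable one_le_two).norm.const_mul (S / (2 * c₀)))
    (h.aestronglyMeasurable hz α) ?_
  filter_upwards [hp] with t ht
  exact norm_quotient_le hS hc₀ hα (ht α hα)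

theorem bracket_eq {z : ℝ} (hz : z ≤ B + ρ) (p : EuclideanSpace ℝ (Fin N)) (α : ℝ) :
    bracket a b B ρ w d p z α =
      -(∫ t in Ioc z (B + ρ), series a b (d t) α / (2 * √(series a b (w t) α))) +
        series a b p α := by
  rw [bracket, intervalIntegral.integral_of_le hz]

theorem abs_bracket_le (h : Admissible a b B ρ c₀ w d) (hS : SeriesBound a b N S)
    (hc₀ : 0 < c₀) {z : ℝ} (hz : z ∈ Icc B (B + ρ)) (p : EuclideanSpace ℝ (Fin N)) {α : ℝ}
    (hα : α ∈ Icc a b) :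
    |bracket a b B ρ w d p z α| ≤
      S / (2 * c₀) * (∫ t in Ioc B (B + ρ), ‖d t‖) + S * ‖p‖ := by
  rw [bracket_eq hz.2]
  refine (abs_add_le _ _).trans (add_le_add ?_ (hS.series p α hα))
  rw [abs_neg, ← integral_const_mul]
  have hS0 := hS.pos
  have hi := (h.memLp_right.integrable one_le_two).norm.const_mul (S / (2 * c₀))
  obtain ⟨hw, hd, hp⟩ := h.mono hz.1
  calc _ ≤ ∫ t in Ioc z (B + ρ), S / (2 * c₀) * ‖d t‖ := by
        refine abs_integral_le_of_norm_le ((hd.integrable one_le_two).norm.const_mul _) ?_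
        filter_upwards [hp] with t ht
        exact norm_quotient_le hS hc₀ hα (ht α hα)
    _ ≤ _ := setIntegral_mono_set hi
        (Filter.Eventually.of_forall fun t => by positivity)
        (Ioc_subset_Ioc_left hz.1).eventuallyLE

/-- Modulus of continuity in `z`, uniform in `α`; it yields continuity of `P` in `z`. -/
theorem abs_bracket_sub_bracket_le (h : Admissible a b B ρ c₀ w d) (hS : SeriesBound a b N S)
    (hc₀ : 0 < c₀) {z z' : ℝ} (hz : B ≤ z) (hzz' : z ≤ z') (hz' : z' ≤ B + ρ)
    (p : EuclideanSpace ℝ (Fin N)) {α : ℝ} (hα : α ∈ Icc a b) :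
    |bracket a b B ρ w d p z α - bracket a b B ρ w d p z' α| ≤
      S / (2 * c₀) * ∫ t in z..z', ‖d t‖ := by
  have hi : ∀ {x}, B ≤ x → x ≤ B + ρ → IntervalIntegrable
      (fun t => series a b (d t) α / (2 * √(series a b (w t) α))) volume x (B + ρ) := by
    intro x hx hx'
    rw [intervalIntegrable_iff_integrableOn_Ioc_of_le hx']
    exact h.integrable_quotient hS hc₀ hx hα
  have hsub := intervalIntegral.integral_interval_sub_interval_comm
    (hi hz (hzz'.trans hz')) (hi (hz.trans hzz') hz')
    ((hi hz (hzz'.trans hz')).trans (hi (hz.trans hzz') hz').symm)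
  rw [intervalIntegral.integral_same, sub_zero] at hsub
  have : bracket a b B ρ w d p z α - bracket a b B ρ w d p z' α =
      -∫ t in z..z', series a b (d t) α / (2 * √(series a b (w t) α)) := by
    simp only [bracket]; rw [← hsub]; ring
  rw [this, abs_neg, ← intervalIntegral.integral_const_mul,
    intervalIntegral.integral_of_le hzz', intervalIntegral.integral_of_le hzz']
  obtain ⟨hw, hd, hp⟩ := h.mono hz
  have hμ : volume.restrict (Ioc z z') ≤ volume.restrict (Ioc z (B + ρ)) :=
    Measure.restrict_mono (Ioc_subset_Ioc_right hz') le_rfl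
  refine abs_integral_le_of_norm_le
    (((hd.integrable one_le_two).norm.const_mul _).mono_measure hμ) ?_
  filter_upwards [ae_mono hμ hp] with t ht
  exact norm_quotient_le hS hc₀ hα (ht α hα)

/-- The Volterra estimate for one bracket: integrate the pointwise bound of
`abs_div_two_sqrt_sub_le` and apply Cauchy–Schwarz. The a priori bound `D` is used for the product
of `d₂` and `w₁ - w₂`. The factor `3` comes from squaring a sum of three terms. -/
theorem sq_bracket_sub_le (h₁ : Admissible a b B ρ c₀ w₁ d₁) (h₂ : Admissible a b B ρ c₀ w₂ d₂)
    (hS : SeriesBound a b N S) (hc₀ : 0 < c₀) {D : ℝ}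
    (hD : ∫ t in Ioc B (B + ρ), ‖d₂ t‖ ^ 2 ≤ D) {z : ℝ} (hz : z ∈ Icc B (B + ρ))
    (p₁ p₂ : EuclideanSpace ℝ (Fin N)) {α : ℝ} (hα : α ∈ Icc a b) :
    (bracket a b B ρ w₁ d₁ p₁ z α - bracket a b B ρ w₂ d₂ p₂ z α) ^ 2 ≤
      3 * ((S / (2 * c₀)) ^ 2 * ρ + (S ^ 2 / (4 * c₀ ^ 3)) ^ 2 * D + S ^ 2) *
        ((∫ t in Ioc z (B + ρ), ‖d₁ t - d₂ t‖ ^ 2) + (∫ t in Ioc z (B + ρ), ‖w₁ t - w₂ t‖ ^ 2) +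
          ‖p₁ - p₂‖ ^ 2) := by
  obtain ⟨hw₁, hd₁, hp₁⟩ := h₁.mono hz.1
  obtain ⟨hw₂, hd₂, hp₂⟩ := h₂.mono hz.1
  have hS0 := hS.pos
  set ν := volume.restrict (Ioc z (B + ρ)) with hν
  have hdd : MemLp (fun t => ‖d₁ t - d₂ t‖) 2 ν := (hd₁.sub hd₂).norm
  have hww : MemLp (fun t => ‖w₁ t - w₂ t‖) 2 ν := (hw₁.sub hw₂).norm
  have hdn : MemLp (fun t => ‖d₂ t‖) 2 ν := hd₂.norm
  have hdw : Integrable (fun t => ‖d₂ t‖ * ‖w₁ t - w₂ t‖) ν := hdn.integrable_mul hww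
  set I₁ := ∫ t, ‖d₁ t - d₂ t‖ ∂ν
  set I₂ := ∫ t, ‖d₂ t‖ * ‖w₁ t - w₂ t‖ ∂ν
  set J₁ := ∫ t, ‖d₁ t - d₂ t‖ ^ 2 ∂ν
  set J₂ := ∫ t, ‖w₁ t - w₂ t‖ ^ 2 ∂ν
  have hJ₁ : 0 ≤ J₁ := integral_nonneg fun t => sq_nonneg _
  have hJ₂ : 0 ≤ J₂ := integral_nonneg fun t => sq_nonneg _
  have hI₁ : 0 ≤ I₁ := integral_nonneg fun t => norm_nonneg _
  have hI₂ : 0 ≤ I₂ := integral_nonneg fun t => by positivity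
  have hρ : 0 ≤ ρ := by linarith [hz.1, hz.2]
  -- Cauchy–Schwarz against the constant function `1` on an interval of length at most `ρ`.
  have c₁ : I₁ ^ 2 ≤ ρ * J₁ := by
    have := sq_integral_mul_le (μ := ν) (f := fun _ => 1) (fun _ => zero_le_one)
      (fun t => norm_nonneg (d₁ t - d₂ t)) (memLp_const 1) hdd
    simp only [one_mul, one_pow, integral_const, smul_eq_mul, mul_one] at this
    refine this.trans (mul_le_mul_of_nonneg_right ?_ hJ₁)
    rw [hν, measureReal_restrict_apply_univ, Real.volume_real_Ioc_of_le hz.2]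
    linarith [hz.1]
  have hd₂le : ∫ t, ‖d₂ t‖ ^ 2 ∂ν ≤ D := by
    refine le_trans (setIntegral_mono_set ?_ (Filter.Eventually.of_forall fun t => sq_nonneg _)
        (Ioc_subset_Ioc_left hz.1).eventuallyLE) hD
    exact h₂.memLp_right.norm.integrable_sq
  have hD0 : 0 ≤ D := (integral_nonneg fun t => sq_nonneg _).trans hd₂le
  have c₂ : I₂ ^ 2 ≤ D * J₂ :=
    (sq_integral_mul_le (μ := ν) (fun t => norm_nonneg (d₂ t))
      (fun t => norm_nonneg (w₁ t - w₂ t)) hdn hww).trans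
      (mul_le_mul_of_nonneg_right hd₂le hJ₂)
  have key : |bracket a b B ρ w₁ d₁ p₁ z α - bracket a b B ρ w₂ d₂ p₂ z α| ≤
      S / (2 * c₀) * I₁ + S ^ 2 / (4 * c₀ ^ 3) * I₂ + S * ‖p₁ - p₂‖ := by
    rw [bracket_eq hz.2, bracket_eq hz.2]
    have e : ∀ A₁ A₂ s₁ s₂ : ℝ, -A₁ + s₁ - (-A₂ + s₂) = -(A₁ - A₂) + (s₁ - s₂) := by
      intros; ring
    rw [e, ← series_sub, ← integral_sub (h₁.integrable_quotient hS hc₀ hz.1 hα)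
      (h₂.integrable_quotient hS hc₀ hz.1 hα)]
    refine (abs_add_le _ _).trans (add_le_add ?_ (hS.series _ α hα))
    rw [abs_neg, ← integral_const_mul, ← integral_const_mul, ← integral_add
      ((hdd.integrable one_le_two).const_mul _) (hdw.const_mul _)]
    refine abs_integral_le_of_norm_le
      (((hdd.integrable one_le_two).const_mul _).add (hdw.const_mul _)) ?_
    filter_upwards [hp₁, hp₂] with t ht₁ ht₂
    refine (abs_div_two_sqrt_sub_le hc₀ (ht₁ α hα) (ht₂ α hα)).trans (add_le_add ?_ ?_)
    · rw [← series_sub, div_mul_eq_mul_div]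
      gcongr
      exact hS.series _ α hα
    · rw [← series_sub, div_mul_eq_mul_div]
      refine div_le_div_of_nonneg_right ?_ (by positivity)
      calc _ ≤ (S * ‖d₂ t‖) * (S * ‖w₁ t - w₂ t‖) :=
            mul_le_mul (hS.series _ α hα) (hS.series _ α hα) (abs_nonneg _) (by positivity)
        _ = _ := by ring
  rw [← sq_abs]
  refine (pow_le_pow_left₀ (abs_nonneg _) key 2).trans ?_
  set A := S / (2 * c₀)
  set A' := S ^ 2 / (4 * c₀ ^ 3)
  set q := ‖p₁ - p₂‖
  have e₁ : (A * I₁) ^ 2 ≤ A ^ 2 * ρ * J₁ := by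
    rw [mul_pow, mul_assoc]; exact mul_le_mul_of_nonneg_left c₁ (sq_nonneg _)
  have e₂ : (A' * I₂) ^ 2 ≤ A' ^ 2 * D * J₂ := by
    rw [mul_pow, mul_assoc]; exact mul_le_mul_of_nonneg_left c₂ (sq_nonneg _)
  have h3 : (A * I₁ + A' * I₂ + S * q) ^ 2 ≤
      3 * ((A * I₁) ^ 2 + (A' * I₂) ^ 2 + (S * q) ^ 2) := by
    nlinarith [sq_nonneg (A * I₁ - A' * I₂), sq_nonneg (A * I₁ - S * q),
      sq_nonneg (A' * I₂ - S * q)]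
  have t₁ : 0 ≤ A ^ 2 * ρ := by positivity
  have t₂ : 0 ≤ A' ^ 2 * D := by positivity
  have t₃ : 0 ≤ S ^ 2 := by positivity
  have t₄ : 0 ≤ q ^ 2 := sq_nonneg q
  have m₁ := mul_nonneg t₁ hJ₂
  have m₂ := mul_nonneg t₁ t₄
  have m₃ := mul_nonneg t₂ hJ₁
  have m₄ := mul_nonneg t₂ t₄
  have m₅ := mul_nonneg t₃ hJ₁
  have m₆ := mul_nonneg t₃ hJ₂
  nlinarith

theorem continuousOn_bracket (h : Admissible a b B ρ c₀ w d) (hS : SeriesBound a b N S)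
    (hc₀ : 0 < c₀) {z : ℝ} (hz : z ∈ Icc B (B + ρ)) (p : EuclideanSpace ℝ (Fin N)) :
    ContinuousOn (bracket a b B ρ w d p z) (Icc a b) := by
  have e : bracket a b B ρ w d p z = _ := funext fun α => bracket_eq hz.2 p α
  rw [e]
  refine ContinuousOn.add (ContinuousOn.neg ?_) (continuous_series a b p).continuousOn
  obtain ⟨hw, hd, hp⟩ := h.mono hz.1
  refine continuousOn_of_dominated (fun α _ => h.aestronglyMeasurable hz.1 α)
    (bound := fun t => S / (2 * c₀) * ‖d t‖) (fun α hα => ?_)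
    ((hd.integrable one_le_two).norm.const_mul _) ?_
  · filter_upwards [hp] with t ht
    exact norm_quotient_le hS hc₀ hα (ht α hα)
  · filter_upwards [hp] with t ht
    refine (continuous_series a b (d t)).continuousOn.div
      (continuousOn_const.mul (continuous_series a b (w t)).sqrt.continuousOn) fun α hα => ?_
    have := Real.sqrt_pos.2 ((pow_pos hc₀ 2).trans_le (ht α hα))
    positivity

/-- Differentiation under the integral sign, with the dominating function `bd` integrable because
`d` and `w` are in `L_2`. The uniform bound `K` makes the derivative integrable, as integration by
parts in `α` requires. -/
theorem exists_hasDerivAt_bracket (h : Admissible a b B ρ c₀ w d) (hS : SeriesBound a b N S)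
    (hc₀ : 0 < c₀) {z : ℝ} (hz : z ∈ Icc B (B + ρ)) (p : EuclideanSpace ℝ (Fin N)) :
    ∃ K, ∀ α ∈ Ioo a b, ∃ D, |D| ≤ K ∧ HasDerivAt (bracket a b B ρ w d p z) D α := by
  obtain ⟨hw, hd, hp⟩ := h.mono hz.1
  have hS0 := hS.pos
  set bd : ℝ → ℝ := fun t =>
    S / (2 * c₀) * ‖d t‖ + S ^ 2 / (4 * c₀ ^ 3) * (‖d t‖ * ‖w t‖) with hbd
  have hbdi : Integrable bd (volume.restrict (Ioc z (B + ρ))) :=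
    ((hd.integrable one_le_two).norm.const_mul _).add ((hd.norm.integrable_mul hw.norm).const_mul _)
  set F' : ℝ → ℝ → ℝ := fun α t => seriesDeriv a b (d t) α / (2 * √(series a b (w t) α)) -
    series a b (d t) α * seriesDeriv a b (w t) α /
      (4 * (√(series a b (w t) α) * series a b (w t) α)) with hF'
  have hbound : ∀ᵐ t ∂volume.restrict (Ioc z (B + ρ)), ∀ α ∈ Ioo a b, ‖F' α t‖ ≤ bd t := by
    filter_upwards [hp] with t ht α hα
    have hα' := Ioo_subset_Icc_self hα
    have hu := ht α hα'
    have hs : c₀ ≤ √(series a b (w t) α) := Real.le_sqrt_of_sq_le hu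
    refine (abs_sub _ _).trans (add_le_add ?_ ?_)
    · refine (abs_div_two_sqrt_le hc₀ hu).trans ?_
      rw [div_mul_eq_mul_div]
      gcongr
      exact hS.seriesDeriv _ α hα'
    · have hu0 := (pow_pos hc₀ 2).trans_le hu
      rw [abs_div, abs_mul, abs_of_pos (by positivity :
        0 < 4 * (√(series a b (w t) α) * series a b (w t) α)), div_mul_eq_mul_div]
      have e1 : |series a b (d t) α| * |seriesDeriv a b (w t) α| ≤ S ^ 2 * (‖d t‖ * ‖w t‖) :=
        calc _ ≤ (S * ‖d t‖) * (S * ‖w t‖) :=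
              mul_le_mul (hS.series _ α hα') (hS.seriesDeriv _ α hα') (abs_nonneg _)
                (by positivity)
          _ = _ := by ring
      have e2 : 4 * c₀ ^ 3 ≤ 4 * (√(series a b (w t) α) * series a b (w t) α) := by
        rw [pow_succ' c₀ 2]
        gcongr
      gcongr
  refine ⟨(∫ t in Ioc z (B + ρ), bd t) + S * ‖p‖, fun α hα => ?_⟩
  refine ⟨-(∫ t in Ioc z (B + ρ), F' α t) + seriesDeriv a b p α, ?_, ?_⟩
  · refine (abs_add_le _ _).trans
      (add_le_add ?_ (hS.seriesDeriv p α (Ioo_subset_Icc_self hα)))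
    rw [abs_neg]
    refine abs_integral_le_of_norm_le hbdi ?_
    filter_upwards [hbound] with t ht using ht α hα
  · have e : bracket a b B ρ w d p z = _ := funext fun α => bracket_eq hz.2 p α
    rw [e]
    refine HasDerivAt.add (HasDerivAt.neg ?_) (hasDerivAt_series a b p α)
    refine (hasDerivAt_integral_of_dominated_loc_of_deriv_le (Ioo_mem_nhds hα.1 hα.2)
      (Filter.Eventually.of_forall fun α => h.aestronglyMeasurable hz.1 α)
      (h.integrable_quotient hS hc₀ hz.1 (Ioo_subset_Icc_self hα)) ?_ hbound hbdi ?_).2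
    · have k1 := fun α => ((continuous_series_left a b α).comp_aestronglyMeasurable hd.1).aemeasurable
      have k2 := fun α => ((continuous_series_left a b α).comp_aestronglyMeasurable hw.1).aemeasurable
      have k3 := fun α =>
        ((continuous_seriesDeriv_left a b α).comp_aestronglyMeasurable hd.1).aemeasurable
      have k4 := fun α =>
        ((continuous_seriesDeriv_left a b α).comp_aestronglyMeasurable hw.1).aemeasurable
      exact (((k3 α).div ((k2 α).sqrt.const_mul 2)).sub (((k1 α).mul (k4 α)).div
        (((k2 α).sqrt.mul (k2 α)).const_mul 4))).aestronglyMeasurable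
    · filter_upwards [hp] with t ht x hx
      have hu0 := (pow_pos hc₀ 2).trans_le (ht x (Ioo_subset_Icc_self hx))
      have hs0 := Real.sqrt_pos.2 hu0
      refine ((hasDerivAt_series a b (d t) x).div
        (((hasDerivAt_series a b (w t) x).sqrt hu0.ne').const_mul 2) (by positivity)).congr_deriv ?_
      have e2 : √(series a b (w t) x) ^ 2 = series a b (w t) x := Real.sq_sqrt hu0.le
      simp only [hF']
      nth_rewrite 6 [← e2]
      field_simp
      ring

end Admissible

/-! ### Removing the derivative in `α`. -/

/-- A continuous function on `[a, b]` with a bounded derivative on `(a, b)`. -/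
def RegularOn (a b : ℝ) (f : ℝ → ℝ) : Prop :=
  ContinuousOn f (Icc a b) ∧ ∃ K, ∀ α ∈ Ioo a b, |deriv f α| ≤ K ∧ DifferentiableAt ℝ f α

theorem Admissible.regularOn_sq_bracket {a b B ρ c₀ S : ℝ} {N : ℕ}
    {w d : ℝ → EuclideanSpace ℝ (Fin N)} (h : Admissible a b B ρ c₀ w d)
    (hS : SeriesBound a b N S) (hc₀ : 0 < c₀) {z : ℝ} (hz : z ∈ Icc B (B + ρ))
    (p : EuclideanSpace ℝ (Fin N)) :
    RegularOn a b fun β => (bracket a b B ρ w d p z β) ^ 2 := by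
  obtain ⟨K, hK⟩ := h.exists_hasDerivAt_bracket hS hc₀ hz p
  refine ⟨(h.continuousOn_bracket hS hc₀ hz p).pow 2,
    2 * (S / (2 * c₀) * (∫ t in Ioc B (B + ρ), ‖d t‖) + S * ‖p‖) * K, fun α hα => ?_⟩
  obtain ⟨D, hD, hder⟩ := hK α hα
  have h2 := hder.fun_pow 2
  refine ⟨?_, h2.differentiableAt⟩
  have hb := h.abs_bracket_le hS hc₀ hz p (Ioo_subset_Icc_self hα)
  rw [h2.deriv, abs_mul, abs_mul]
  simp only [Nat.cast_ofNat, Nat.abs_ofNat, Nat.reduceSub, pow_one]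
  have := (abs_nonneg _).trans hb
  gcongr

theorem RegularOn.intervalIntegrable_deriv {a b : ℝ} (hab : a < b) {f : ℝ → ℝ}
    (hf : RegularOn a b f) : IntervalIntegrable (deriv f) volume a b := by
  obtain ⟨-, K, hK⟩ := hf
  rw [intervalIntegrable_iff_integrableOn_Ioo_of_le hab.le]
  refine Measure.integrableOn_of_bounded (M := K) (by simp)
    (measurable_deriv f).aestronglyMeasurable ?_
  filter_upwards [ae_restrict_mem measurableSet_Ioo] with α hα using (hK α hα).1

/-- For `s = 1`, integration by parts moves the derivative to `Φ_n`, so a uniform bound on `f - g`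
suffices. In the constant, `2` accounts for the two end points and `b - a` for the remaining
integral. -/
theorem abs_integral_phi_iteratedDeriv_sub_le {a b S ε : ℝ} {N s : ℕ} (hs : s ≤ 1) (hab : a < b)
    (hS : SeriesBound a b N S) {f g : ℝ → ℝ} (hf : RegularOn a b f) (hg : RegularOn a b g)
    (hfg : ∀ α ∈ Icc a b, |f α - g α| ≤ ε) (n : Fin N) :
    |(∫ α in a..b, phi a b n α * iteratedDeriv s f α) -
      ∫ α in a..b, phi a b n α * iteratedDeriv s g α| ≤ S * (2 + (b - a)) * ε := by
  have hab' : uIcc a b = Icc a b := uIcc_of_le hab.le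
  have hS0 := hS.pos
  have hε : 0 ≤ ε := (abs_nonneg _).trans (hfg a (left_mem_Icc.2 hab.le))
  have key : ∀ ψ : ℝ → ℝ, Continuous ψ → (∀ α ∈ Icc a b, |ψ α| ≤ S) →
      |(∫ α in a..b, ψ α * f α) - ∫ α in a..b, ψ α * g α| ≤ S * (b - a) * ε := by
    intro ψ hψ hψS
    have hi : ∀ {f : ℝ → ℝ}, RegularOn a b f →
        IntervalIntegrable (fun α => ψ α * f α) volume a b := fun hf =>
      (hψ.continuousOn.mul (hab' ▸ hf.1)).intervalIntegrable
    rw [← intervalIntegral.integral_sub (hi hf) (hi hg)]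
    refine (intervalIntegral.norm_integral_le_of_norm_le_const (C := S * ε)
      (f := fun α => ψ α * f α - ψ α * g α) fun α hα => ?_).trans
      (le_of_eq ?_)
    · rw [uIoc_of_le hab.le] at hα
      have hα' := Ioc_subset_Icc_self hα
      rw [← mul_sub, Real.norm_eq_abs, abs_mul]
      exact mul_le_mul (hψS α hα') (hfg α hα') (abs_nonneg _) hS0.le
    · rw [abs_of_pos (sub_pos.2 hab)]; ring
  rcases Nat.le_one_iff_eq_zero_or_eq_one.1 hs with rfl | rfl
  · simp only [iteratedDeriv_zero]
    refine (key _ (continuous_phi a b n) (hS.phi n)).trans ?_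
    gcongr
    linarith
  · simp only [iteratedDeriv_one]
    have ibp : ∀ {f : ℝ → ℝ}, RegularOn a b f → ∫ α in a..b, phi a b n α * deriv f α =
        phi a b n b * f b - phi a b n a * f a - ∫ α in a..b, deriv (phi a b n) α * f α := by
      intro f hf
      refine intervalIntegral.integral_mul_deriv_eq_deriv_mul_of_hasDerivAt
        (continuous_phi a b n).continuousOn (hab' ▸ hf.1) (fun α _ => ?_) (fun α hα => ?_)
        ((continuous_deriv_phi a b n).intervalIntegrable _ _) (hf.intervalIntegrable_deriv hab)
      · exact (hasDerivAt_phi a b n α).differentiableAt.hasDerivAt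
      · rw [min_eq_left hab.le, max_eq_right hab.le] at hα
        exact (hf.2.choose_spec α hα).2.hasDerivAt
    rw [ibp hf, ibp hg]
    have k := key _ (continuous_deriv_phi a b n) (hS.deriv_phi n)
    have endpt : ∀ α ∈ Icc a b, |phi a b n α * f α - phi a b n α * g α| ≤ S * ε := by
      intro α hα
      rw [← mul_sub, abs_mul]
      exact mul_le_mul (hS.phi n α hα) (hfg α hα) (abs_nonneg _) hS0.le
    have e1 := endpt a (left_mem_Icc.2 hab.le)
    have e2 := endpt b (right_mem_Icc.2 hab.le)
    rw [abs_le] at *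
    constructor <;> nlinarith [k.1, k.2, e1.1, e1.2, e2.1, e2.2]

end TravelTime

end

/-! ### Grid functions, their central differences and square integrability. -/

noncomputable section

namespace TravelTime

open MeasureTheory Set

/-- The sum of the squared norms of the values at all nodes. -/
def gridSq {m : ℕ} {V : Type*} [NormedAddCommGroup V] (Q : Fin m → Fin m → V) : ℝ :=
  ∑ i, ∑ j, ‖Q i j‖ ^ 2

section Grid

variable {k m : ℕ} {V : Type*} [NormedAddCommGroup V]

theorem gridSq_nonneg (Q : Fin m → Fin m → V) : 0 ≤ gridSq Q :=
  Finset.sum_nonneg fun _ _ => Finset.sum_nonneg fun _ _ => sq_nonneg _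

theorem norm_sq_le_gridSq (Q : Fin m → Fin m → V) (i j : Fin m) : ‖Q i j‖ ^ 2 ≤ gridSq Q :=
  (Finset.single_le_sum (f := fun j => ‖Q i j‖ ^ 2) (fun _ _ => sq_nonneg _)
    (Finset.mem_univ j)).trans
    (Finset.single_le_sum (f := fun i => ∑ j, ‖Q i j‖ ^ 2)
      (fun _ _ => Finset.sum_nonneg fun _ _ => sq_nonneg _) (Finset.mem_univ i))

variable [NormedSpace ℝ V]

theorem norm_smul_sub_sq_le (c : ℝ) (Q : Fin m → Fin m → V) (i j i' j' : Fin m) :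
    ‖c • (Q i j - Q i' j')‖ ^ 2 ≤ 4 * c ^ 2 * gridSq Q := by
  have h := norm_sub_le (Q i j) (Q i' j')
  have h1 := norm_sq_le_gridSq Q i j
  have h2 := norm_sq_le_gridSq Q i' j'
  rw [norm_smul, mul_pow, Real.norm_eq_abs, sq_abs]
  have : ‖Q i j - Q i' j'‖ ^ 2 ≤ 4 * gridSq Q := by
    nlinarith [sq_nonneg (‖Q i j‖ - ‖Q i' j'‖), norm_nonneg (Q i j - Q i' j')]
  nlinarith [sq_nonneg c]

/-- The squared norms of central differences are at most `diffBound k` times `gridSq`. -/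
def diffBound (k : ℕ) : ℝ := 4 * ((2 * (1 / (k : ℝ)))⁻¹) ^ 2

theorem diffBound_nonneg (k : ℕ) : 0 ≤ diffBound k := by unfold diffBound; positivity

theorem norm_dx_sq_le (Q : Fin (k + 1) → Fin (k + 1) → V) (i j : Fin (k - 1)) :
    ‖dx Q i j‖ ^ 2 ≤ diffBound k * gridSq Q :=
  norm_smul_sub_sq_le _ Q _ _ _ _

theorem norm_dy_sq_le (Q : Fin (k + 1) → Fin (k + 1) → V) (i j : Fin (k - 1)) :
    ‖dy Q i j‖ ^ 2 ≤ diffBound k * gridSq Q :=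
  norm_smul_sub_sq_le _ Q _ _ _ _

end Grid

theorem dx_sub_dx {k : ℕ} {V : Type*} [AddCommGroup V] [Module ℝ V]
    (Q Q' : Fin (k + 1) → Fin (k + 1) → V) (i j : Fin (k - 1)) :
    dx Q i j - dx Q' i j = dx (Q - Q') i j := by
  simp only [dx, Pi.sub_apply, smul_sub]; abel

theorem dy_sub_dy {k : ℕ} {V : Type*} [AddCommGroup V] [Module ℝ V]
    (Q Q' : Fin (k + 1) → Fin (k + 1) → V) (i j : Fin (k - 1)) :
    dy Q i j - dy Q' i j = dy (Q - Q') i j := by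
  simp only [dy, Pi.sub_apply, smul_sub]; abel

section SemiFun

variable {B ρ : ℝ} {k N : ℕ} {W : SemiFun k N}

theorem memH1_iff : MemH1 B ρ W ↔
    ∀ i j, MemLp (W i j) 2 (volume.restrict (Ioc B (B + ρ))) := by
  simp only [MemH1, restrict_Ioo_eq_restrict_Ioc]

theorem MemH1.sub {W' : SemiFun k N} (h : MemH1 B ρ W) (h' : MemH1 B ρ W') :
    MemH1 B ρ (W - W') := fun i j => (h i j).sub (h' i j)

theorem MemH1.memLp_dx (h : MemH1 B ρ W) (i j : Fin (k - 1)) :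
    MemLp (dx W i j) 2 (volume.restrict (Ioc B (B + ρ))) :=
  ((memH1_iff.1 h _ _).sub (memH1_iff.1 h _ _)).const_smul _

theorem MemH1.memLp_dy (h : MemH1 B ρ W) (i j : Fin (k - 1)) :
    MemLp (dy W i j) 2 (volume.restrict (Ioc B (B + ρ))) :=
  ((memH1_iff.1 h _ _).sub (memH1_iff.1 h _ _)).const_smul _

theorem MemH1.integrable_gridSq (h : MemH1 B ρ W) :
    Integrable (fun t => gridSq fun i j => W i j t) (volume.restrict (Ioc B (B + ρ))) :=
  integrable_finsetSum _ fun i _ => integrable_finsetSum _ fun j _ =>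
    (memH1_iff.1 h i j).norm.integrable_sq

theorem MemH1.integrable_gridSq_of_le (h : MemH1 B ρ W) {z : ℝ} (hz : B ≤ z) :
    Integrable (fun t => gridSq fun i j => W i j t) (volume.restrict (Ioc z (B + ρ))) :=
  h.integrable_gridSq.mono_measure
    (Measure.restrict_mono (Ioc_subset_Ioc_left hz) le_rfl)

theorem l2Sq_eq_integral_gridSq (hρ : 0 ≤ ρ) (h : MemH1 B ρ W) :
    l2Sq B ρ W = ∫ t in Ioc B (B + ρ), gridSq fun i j => W i j t := by
  have hi : ∀ i j, Integrable (fun t => ‖W i j t‖ ^ 2) (volume.restrict (Ioc B (B + ρ))) :=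
    fun i j => (memH1_iff.1 h i j).norm.integrable_sq
  simp only [l2Sq, gridSq, intervalIntegral.integral_of_le (by linarith : B ≤ B + ρ)]
  rw [integral_finsetSum _ fun i _ => integrable_finsetSum _ fun j _ => hi i j]
  exact Finset.sum_congr rfl fun i _ => (integral_finsetSum _ fun j _ => hi i j).symm

theorem MemH1.integral_norm_sq_le (h : MemH1 B ρ W) {z : ℝ} (hz : B ≤ z) {C : ℝ}
    {v : ℝ → EuclideanSpace ℝ (Fin N)}
    (hv : ∀ t, ‖v t‖ ^ 2 ≤ C * gridSq fun i j => W i j t) :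
    ∫ t in Ioc z (B + ρ), ‖v t‖ ^ 2 ≤
      C * ∫ t in Ioc z (B + ρ), gridSq fun i j => W i j t := by
  rw [← integral_const_mul]
  exact integral_mono_of_nonneg (Filter.Eventually.of_forall fun t => sq_nonneg _)
    ((h.integrable_gridSq_of_le hz).const_mul _) (Filter.Eventually.of_forall hv)

theorem integral_gridSq_nonneg (W : SemiFun k N) (z z' : ℝ) :
    0 ≤ ∫ t in Ioc z z', gridSq fun i j => W i j t :=
  integral_nonneg fun _ => gridSq_nonneg _

end SemiFun

/-- `W` is square integrable with `‖W‖² ≤ D` in `L_2`, and `u ≥ c₀²` almost everywhere. -/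
structure AdmissibleFun (a b B ρ c₀ D : ℝ) {k N : ℕ} (W : SemiFun k N) : Prop where
  memH1 : MemH1 B ρ W
  le_series : ∀ i j, ∀ᵐ t ∂volume.restrict (Ioc B (B + ρ)),
    ∀ α ∈ Icc a b, c₀ ^ 2 ≤ series a b (W i j t) α
  integral_le : ∫ t in Ioc B (B + ρ), gridSq (fun i j => W i j t) ≤ D

namespace AdmissibleFun

variable {a b B ρ c₀ D S : ℝ} {k N : ℕ} {W W₁ W₂ : SemiFun k N}

theorem admissible_dx (h : AdmissibleFun a b B ρ c₀ D W) (i j : Fin (k - 1)) :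
    Admissible a b B ρ c₀ (W (mid i) (mid j)) (dx W i j) :=
  ⟨memH1_iff.1 h.memH1 _ _, h.memH1.memLp_dx i j, h.le_series _ _⟩

theorem admissible_dy (h : AdmissibleFun a b B ρ c₀ D W) (i j : Fin (k - 1)) :
    Admissible a b B ρ c₀ (W (mid i) (mid j)) (dy W i j) :=
  ⟨memH1_iff.1 h.memH1 _ _, h.memH1.memLp_dy i j, h.le_series _ _⟩

theorem integral_norm_dx_sq_le (h : AdmissibleFun a b B ρ c₀ D W) (i j : Fin (k - 1)) :
    ∫ t in Ioc B (B + ρ), ‖dx W i j t‖ ^ 2 ≤ diffBound k * D :=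
  (h.memH1.integral_norm_sq_le le_rfl fun t => norm_dx_sq_le (fun i j => W i j t) i j).trans
    (mul_le_mul_of_nonneg_left h.integral_le (diffBound_nonneg k))

theorem integral_norm_dy_sq_le (h : AdmissibleFun a b B ρ c₀ D W) (i j : Fin (k - 1)) :
    ∫ t in Ioc B (B + ρ), ‖dy W i j t‖ ^ 2 ≤ diffBound k * D :=
  (h.memH1.integral_norm_sq_le le_rfl fun t => norm_dy_sq_le (fun i j => W i j t) i j).trans
    (mul_le_mul_of_nonneg_left h.integral_le (diffBound_nonneg k))

end AdmissibleFun

theorem Admissible.abs_bracket_le_of_integral_le {a b B ρ c₀ S D q : ℝ} {N : ℕ}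
    {w d : ℝ → EuclideanSpace ℝ (Fin N)} (h : Admissible a b B ρ c₀ w d)
    (hS : SeriesBound a b N S) (hc₀ : 0 < c₀)
    (hD : ∫ t in Ioc B (B + ρ), ‖d t‖ ^ 2 ≤ D) {z : ℝ} (hz : z ∈ Icc B (B + ρ))
    {p : EuclideanSpace ℝ (Fin N)} (hp : ‖p‖ ≤ q) {α : ℝ} (hα : α ∈ Icc a b) :
    |bracket a b B ρ w d p z α| ≤ S / (2 * c₀) * (ρ + D) + S * q := by
  have hS0 := hS.pos
  have hρ : 0 ≤ ρ := by linarith [hz.1, hz.2]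
  refine (h.abs_bracket_le hS hc₀ hz p hα).trans ?_
  have hi := h.memLp_right.norm.integrable_sq
  have : ∫ t in Ioc B (B + ρ), ‖d t‖ ≤ ρ + D := by
    calc _ ≤ ∫ t in Ioc B (B + ρ), (1 + ‖d t‖ ^ 2) :=
          integral_mono (h.memLp_right.integrable one_le_two).norm
            ((integrable_const 1).add hi) fun t => by
              simp only; nlinarith [sq_nonneg (‖d t‖ - 1)]
      _ ≤ _ := by
          rw [integral_add (integrable_const 1) hi]
          simpa [hρ] using hD
  gcongr

theorem abs_sq_sub_sq_le {x y β e : ℝ} (hx : |x| ≤ β) (hy : |y| ≤ β) (he : |x - y| ≤ e) :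
    |x ^ 2 - y ^ 2| ≤ 2 * β * e := by
  have : x ^ 2 - y ^ 2 = (x + y) * (x - y) := by ring
  rw [this, abs_mul]
  exact mul_le_mul ((abs_add_le x y).trans (by linarith)) he (abs_nonneg _)
    (by linarith [abs_nonneg x])

/-! ### The Lipschitz estimate and continuity of `P`, and measurability of the residual. -/

/-- The square of the operator `P` is Lipschitz in the data and in the solution; only the values of
the solution above the level `z` matter. -/
theorem exists_sq_opP_sub_le {s : ℕ} (hs : s ≤ 1) {a b B ρ c₀ D : ℝ} (q : ℝ) (k N : ℕ)
    (hab : a < b) (hρ : 0 < ρ) (hc₀ : 0 < c₀) (hD : 0 ≤ D) :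
    ∃ L ≥ 0, ∀ (G₁ G₂ : Fin (k + 1) → Fin (k + 1) → EuclideanSpace ℝ (Fin N))
      (W₁ W₂ : SemiFun k N), AdmissibleFun a b B ρ c₀ D W₁ → AdmissibleFun a b B ρ c₀ D W₂ →
      gridSq G₁ ≤ q → gridSq G₂ ≤ q → ∀ z ∈ Icc B (B + ρ), ∀ n i j,
      (opP s a b B ρ G₁ W₁ n i j z - opP s a b B ρ G₂ W₂ n i j z) ^ 2 ≤
        L * ((∫ t in Ioc z (B + ρ), gridSq fun i j => (W₁ - W₂) i j t) + gridSq (G₁ - G₂)) := by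
  obtain ⟨S, hS⟩ := exists_seriesBound a b N
  have hS0 := hS.pos
  obtain ⟨κ, hκ⟩ : ∃ κ, κ = diffBound k := ⟨_, rfl⟩
  have hκ0 : 0 ≤ κ := hκ ▸ diffBound_nonneg k
  obtain ⟨L₀, hL₀⟩ : ∃ L₀, L₀ =
      3 * ((S / (2 * c₀)) ^ 2 * ρ + (S ^ 2 / (4 * c₀ ^ 3)) ^ 2 * (κ * D) + S ^ 2) := ⟨_, rfl⟩
  have hL₀0 : 0 ≤ L₀ := by rw [hL₀]; positivity
  -- `β` bounds every bracket that occurs, so squaring a bracket costs a factor `2 * β`.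
  obtain ⟨β, hβ⟩ : ∃ β, β = S / (2 * c₀) * (ρ + κ * D) + S * √(κ * q) := ⟨_, rfl⟩
  -- The two directions contribute `2 * β` each; `2 * κ + 1` dominates the coefficients in `κ X + X
  -- + κ Y`.
  refine ⟨(S * (2 + (b - a)) * (4 * β)) ^ 2 * (L₀ * (2 * κ + 1)), by positivity, ?_⟩
  intro G₁ G₂ W₁ W₂ h₁ h₂ hG₁ hG₂ z hz n i j
  obtain ⟨X, hX⟩ : ∃ X, X = ∫ t in Ioc z (B + ρ), gridSq fun i j => (W₁ - W₂) i j t := ⟨_, rfl⟩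
  obtain ⟨Y, hY⟩ : ∃ Y, Y = gridSq (G₁ - G₂) := ⟨_, rfl⟩
  have hX0 : 0 ≤ X := hX ▸ integral_gridSq_nonneg _ _ _
  have hY0 : 0 ≤ Y := hY ▸ gridSq_nonneg _
  rw [← hX, ← hY]
  have hsub := h₁.memH1.sub h₂.memH1
  have dir : ∀ {d₁ d₂ : ℝ → EuclideanSpace ℝ (Fin N)} {p₁ p₂ : EuclideanSpace ℝ (Fin N)},
      Admissible a b B ρ c₀ (W₁ (mid i) (mid j)) d₁ →
      Admissible a b B ρ c₀ (W₂ (mid i) (mid j)) d₂ →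
      ∫ t in Ioc B (B + ρ), ‖d₁ t‖ ^ 2 ≤ κ * D → ∫ t in Ioc B (B + ρ), ‖d₂ t‖ ^ 2 ≤ κ * D →
      ‖p₁‖ ^ 2 ≤ κ * q → ‖p₂‖ ^ 2 ≤ κ * q →
      (∀ t, ‖d₁ t - d₂ t‖ ^ 2 ≤ κ * gridSq fun i j => (W₁ - W₂) i j t) →
      ‖p₁ - p₂‖ ^ 2 ≤ κ * Y →
      |(∫ α in a..b, phi a b n α * iteratedDeriv s
          (fun β => (bracket a b B ρ (W₁ (mid i) (mid j)) d₁ p₁ z β) ^ 2) α) -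
        ∫ α in a..b, phi a b n α * iteratedDeriv s
          (fun β => (bracket a b B ρ (W₂ (mid i) (mid j)) d₂ p₂ z β) ^ 2) α| ≤
        S * (2 + (b - a)) * (2 * β * √(L₀ * (2 * κ + 1) * (X + Y))) := by
    intro d₁ d₂ p₁ p₂ a₁ a₂ hd₁ hd₂ hp₁ hp₂ hd hp
    refine abs_integral_phi_iteratedDeriv_sub_le hs hab hS (a₁.regularOn_sq_bracket hS hc₀ hz p₁)
      (a₂.regularOn_sq_bracket hS hc₀ hz p₂) (fun α hα => ?_) n
    rw [hβ]
    refine abs_sq_sub_sq_le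
      (a₁.abs_bracket_le_of_integral_le hS hc₀ hd₁ hz (Real.le_sqrt_of_sq_le hp₁) hα)
      (a₂.abs_bracket_le_of_integral_le hS hc₀ hd₂ hz (Real.le_sqrt_of_sq_le hp₂) hα) ?_
    have e₁ := hsub.integral_norm_sq_le hz.1 hd
    have e₂ := hsub.integral_norm_sq_le (v := fun t => W₁ (mid i) (mid j) t - W₂ (mid i) (mid j) t)
      hz.1 (C := 1) fun t => by
        rw [one_mul]; exact norm_sq_le_gridSq (fun i j => (W₁ - W₂) i j t) (mid i) (mid j)
    rw [← hX] at e₁ e₂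
    refine Real.abs_le_sqrt ((a₁.sq_bracket_sub_le a₂ hS hc₀ hd₂ hz p₁ p₂ hα).trans ?_)
    rw [← hL₀, mul_assoc]
    refine mul_le_mul_of_nonneg_left ?_ hL₀0
    nlinarith [mul_nonneg hκ0 hX0, mul_nonneg hκ0 hY0]
  have hgq : ∀ {G : Fin (k + 1) → Fin (k + 1) → EuclideanSpace ℝ (Fin N)}, gridSq G ≤ q →
      κ * gridSq G ≤ κ * q := fun h => mul_le_mul_of_nonneg_left h hκ0
  have hx := dir (h₁.admissible_dx i j) (h₂.admissible_dx i j)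
    (hκ ▸ h₁.integral_norm_dx_sq_le i j) (hκ ▸ h₂.integral_norm_dx_sq_le i j)
    ((hκ ▸ norm_dx_sq_le G₁ i j).trans (hgq hG₁)) ((hκ ▸ norm_dx_sq_le G₂ i j).trans (hgq hG₂))
    (fun t => by
      have := norm_dx_sq_le (fun i j => (W₁ - W₂) i j t) i j
      rw [← Pi.sub_apply, dx_sub_dx, hκ]; exact this)
    (by rw [dx_sub_dx, hκ, hY]; exact norm_dx_sq_le _ i j)
  have hy := dir (h₁.admissible_dy i j) (h₂.admissible_dy i j)
    (hκ ▸ h₁.integral_norm_dy_sq_le i j) (hκ ▸ h₂.integral_norm_dy_sq_le i j)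
    ((hκ ▸ norm_dy_sq_le G₁ i j).trans (hgq hG₁)) ((hκ ▸ norm_dy_sq_le G₂ i j).trans (hgq hG₂))
    (fun t => by
      have := norm_dy_sq_le (fun i j => (W₁ - W₂) i j t) i j
      rw [← Pi.sub_apply, dy_sub_dy, hκ]; exact this)
    (by rw [dy_sub_dy, hκ, hY]; exact norm_dy_sq_le _ i j)
  obtain ⟨r, hr⟩ : ∃ r, r = √(L₀ * (2 * κ + 1) * (X + Y)) := ⟨_, rfl⟩
  rw [← hr] at hx hy
  have hr2 : r ^ 2 = L₀ * (2 * κ + 1) * (X + Y) := by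
    rw [hr]; exact Real.sq_sqrt (by positivity)
  have hfin : |opP s a b B ρ G₁ W₁ n i j z - opP s a b B ρ G₂ W₂ n i j z| ≤
      S * (2 + (b - a)) * (4 * β) * r := by
    simp only [opP]
    rw [add_sub_add_comm]
    refine (abs_add_le _ _).trans ((add_le_add hx hy).trans (le_of_eq ?_))
    ring
  rw [← sq_abs]
  refine (pow_le_pow_left₀ (abs_nonneg _) hfin 2).trans (le_of_eq ?_)
  rw [mul_pow, hr2]; ring

theorem continuousOn_of_abs_sub_le {f g : ℝ → ℝ} {K : ℝ} {s : Set ℝ} (hg : ContinuousOn g s)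
    (h : ∀ x ∈ s, ∀ y ∈ s, x ≤ y → |f x - f y| ≤ K * |g x - g y|) : ContinuousOn f s := by
  intro x hx
  rw [ContinuousWithinAt, tendsto_iff_dist_tendsto_zero]
  have hg' := (tendsto_iff_dist_tendsto_zero.1 (hg x hx)).const_mul K
  rw [mul_zero] at hg'
  refine squeeze_zero' (Filter.Eventually.of_forall fun _ => dist_nonneg) ?_ hg'
  filter_upwards [self_mem_nhdsWithin] with y hy
  rw [Real.dist_eq, Real.dist_eq]
  rcases le_total x y with hxy | hxy
  · rw [abs_sub_comm, abs_sub_comm (g y)]; exact h x hx y hy hxy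
  · exact h y hy x hx hxy

/-- Increments of `P` in `z` are dominated by those of the continuous primitive of `‖d‖`. -/
theorem AdmissibleFun.continuousOn_opP {s : ℕ} (hs : s ≤ 1) {a b B ρ c₀ D : ℝ} {k N : ℕ}
    (hab : a < b) (hρ : 0 < ρ) (hc₀ : 0 < c₀)
    (G : Fin (k + 1) → Fin (k + 1) → EuclideanSpace ℝ (Fin N)) {W : SemiFun k N}
    (h : AdmissibleFun a b B ρ c₀ D W) (n : Fin N) (i j : Fin (k - 1)) :
    ContinuousOn (opP s a b B ρ G W n i j) (Icc B (B + ρ)) := by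
  obtain ⟨S, hS⟩ := exists_seriesBound a b N
  have hS0 := hS.pos
  have hB : B ≤ B + ρ := by linarith
  have dir : ∀ {w d : ℝ → EuclideanSpace ℝ (Fin N)} (p : EuclideanSpace ℝ (Fin N)),
      Admissible a b B ρ c₀ w d → ContinuousOn (fun z => ∫ α in a..b, phi a b n α *
        iteratedDeriv s (fun β => (bracket a b B ρ w d p z β) ^ 2) α) (Icc B (B + ρ)) := by
    intro w d p ha
    have hd := (ha.memLp_right.integrable one_le_two).norm
    have hdi : IntervalIntegrable (fun t => ‖d t‖) volume B (B + ρ) :=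
      (intervalIntegrable_iff_integrableOn_Ioc_of_le hB).2 hd
    have hprim : ContinuousOn (fun z => ∫ t in B..z, ‖d t‖) (Icc B (B + ρ)) := by
      have := intervalIntegral.continuousOn_primitive_interval' hdi left_mem_uIcc
      rwa [uIcc_of_le hB] at this
    set β := S / (2 * c₀) * (∫ t in Ioc B (B + ρ), ‖d t‖) + S * ‖p‖
    refine continuousOn_of_abs_sub_le hprim
      (K := S * (2 + (b - a)) * (2 * β * (S / (2 * c₀)))) fun z hz z' hz' hzz' => ?_
    have hsub : |(∫ t in B..z, ‖d t‖) - ∫ t in B..z', ‖d t‖| = ∫ t in z..z', ‖d t‖ := by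
      rw [abs_sub_comm, intervalIntegral.integral_interval_sub_left]
      · exact abs_of_nonneg (intervalIntegral.integral_nonneg hzz' fun _ _ => norm_nonneg _)
      · exact hdi.mono_set (by
          rw [uIcc_of_le hz'.1, uIcc_of_le hB]; exact Icc_subset_Icc_right hz'.2)
      · exact hdi.mono_set (by
          rw [uIcc_of_le hz.1, uIcc_of_le hB]; exact Icc_subset_Icc_right hz.2)
    rw [hsub]
    refine (abs_integral_phi_iteratedDeriv_sub_le hs hab hS (ha.regularOn_sq_bracket hS hc₀ hz p)
      (ha.regularOn_sq_bracket hS hc₀ hz' p) (fun α hα => abs_sq_sub_sq_le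
        (ha.abs_bracket_le hS hc₀ hz p hα) (ha.abs_bracket_le hS hc₀ hz' p hα)
        (ha.abs_bracket_sub_bracket_le hS hc₀ hz.1 hzz' hz'.2 p hα)) n).trans (le_of_eq ?_)
    ring
  exact (dir _ (h.admissible_dx i j)).add (dir _ (h.admissible_dy i j))

/-- The linear part is in `L_2`, and `P` is continuous on a compact interval, hence bounded. Without
integrability the integral in the functional would have the default value `0` and carry no
information on the residual. -/
theorem AdmissibleFun.integrable_norm_residual_sq {s : ℕ} (hs : s ≤ 1) {a b B ρ c₀ D : ℝ}
    {k N : ℕ} (hab : a < b) (hρ : 0 < ρ) (hc₀ : 0 < c₀)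
    (G : Fin (k + 1) → Fin (k + 1) → EuclideanSpace ℝ (Fin N)) {W : SemiFun k N}
    (h : AdmissibleFun a b B ρ c₀ D W) (i j : Fin (k - 1)) :
    AEStronglyMeasurable (residual s a b B ρ G W i j) (volume.restrict (Ioc B (B + ρ))) ∧
      Integrable (fun z => ‖residual s a b B ρ G W i j z‖ ^ 2)
        (volume.restrict (Ioc B (B + ρ))) := by
  have hμ : volume.restrict (Ioc B (B + ρ)) ≤ volume.restrict (Icc B (B + ρ)) :=
    Measure.restrict_mono Ioc_subset_Icc_self le_rfl
  have hcomp : ∀ n : Fin N, MemLp (fun z => (∑ m : Fin N, matM a b N n m *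
      W (mid i) (mid j) z m) + opP s a b B ρ G W n i j z) 2
      (volume.restrict (Ioc B (B + ρ))) := by
    intro n
    refine MemLp.add (memLp_finsetSum _ fun m _ => ?_) ?_
    · refine MemLp.const_mul ?_ _
      exact (EuclideanSpace.proj (𝕜 := ℝ) m).comp_memLp' (memH1_iff.1 h.memH1 (mid i) (mid j))
    · have hc := h.continuousOn_opP hs hab hρ hc₀ G n i j
      obtain ⟨C, hC⟩ := isCompact_Icc.exists_bound_of_continuousOn hc
      refine (MemLp.of_bound (hc.aestronglyMeasurable measurableSet_Icc) C ?_).mono_measure hμ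
      filter_upwards [ae_restrict_mem measurableSet_Icc] with z hz using hC z hz
  constructor
  · refine (PiLp.continuous_toLp 2 _).comp_aestronglyMeasurable ?_
    exact (aemeasurable_pi_lambda _ fun n => (hcomp n).1.aemeasurable).aestronglyMeasurable
  · simp only [residual, EuclideanSpace.real_norm_sq_eq]
    exact integrable_finsetSum _ fun n _ => (hcomp n).integrable_sq

theorem residual_sub_residual (s : ℕ) (a b B ρ : ℝ) {k N : ℕ}
    (G₁ G₂ : Fin (k + 1) → Fin (k + 1) → EuclideanSpace ℝ (Fin N)) (W₁ W₂ : SemiFun k N)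
    (i j : Fin (k - 1)) (z : ℝ) :
    residual s a b B ρ G₁ W₁ i j z - residual s a b B ρ G₂ W₂ i j z =
      WithLp.toLp 2 (fun n => ∑ m : Fin N, matM a b N n m *
        (W₁ (mid i) (mid j) z - W₂ (mid i) (mid j) z) m) +
      WithLp.toLp 2 (fun n => opP s a b B ρ G₁ W₁ n i j z - opP s a b B ρ G₂ W₂ n i j z) := by
  ext n
  simp only [residual, PiLp.sub_apply, PiLp.add_apply, mul_sub, Finset.sum_sub_distrib]
  ring

end TravelTime

end

/-! ### Backward Gronwall inequality and a criterion for vanishing almost everywhere. -/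

noncomputable section

namespace TravelTime

open MeasureTheory Set

/-- A backward Gronwall inequality in integrated form. -/
theorem integral_le_of_ae_le_add_integral {B ρ K A : ℝ} (hρ : 0 ≤ ρ) (hK : 0 < K) {φ ψ : ℝ → ℝ}
    (hφ0 : ∀ t, 0 ≤ φ t) (hψ0 : ∀ t, 0 ≤ ψ t)
    (hφ : Integrable φ (volume.restrict (Ioc B (B + ρ))))
    (hψ : Integrable ψ (volume.restrict (Ioc B (B + ρ))))
    (hA : ∫ t in Ioc B (B + ρ), ψ t ≤ A)
    (h : ∀ᵐ z ∂volume.restrict (Ioc B (B + ρ)), φ z ≤ ψ z + K * ∫ t in Ioc z (B + ρ), φ t) :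
    ∫ t in Ioc B (B + ρ), φ t ≤ A * Real.exp (K * ρ) := by
  set T := B + ρ with hT
  -- Extension by zero makes the primitive `E` continuous on the whole line.
  set φ' : ℝ → ℝ := (Ioc B T).indicator φ with hφ'
  have hφ'i : Integrable φ' := (integrable_indicator_iff measurableSet_Ioc).2 hφ
  have hφ'0 : ∀ t, 0 ≤ φ' t := fun t => indicator_nonneg (fun t _ => hφ0 t) t
  set E : ℝ → ℝ := fun z => ∫ t in z..T, φ' t with hE
  have hEc : Continuous E := by
    have : E = fun z => -∫ t in T..z, φ' t := funext fun z => intervalIntegral.integral_symm _ _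
    rw [this]
    exact (intervalIntegral.continuous_primitive (fun a b => hφ'i.intervalIntegrable) T).neg
  have hEeq : ∀ z ∈ Icc B T, E z = ∫ t in Ioc z T, φ t := by
    intro z hz
    simp only [hE]
    rw [intervalIntegral.integral_of_le hz.2]
    refine setIntegral_congr_fun measurableSet_Ioc fun t ht => ?_
    exact indicator_of_mem (Ioc_subset_Ioc_left hz.1 ht) φ
  have hE0 : ∀ z ≤ T, 0 ≤ E z := fun z hz =>
    intervalIntegral.integral_nonneg hz fun t _ => hφ'0 t
  have hstep : ∀ z ∈ Icc B T, E z ≤ A + K * ∫ t in z..T, E t := by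
    intro z hz
    have hsub : Ioc z T ⊆ Ioc B T := Ioc_subset_Ioc_left hz.1
    have hμ : volume.restrict (Ioc z T) ≤ volume.restrict (Ioc B T) :=
      Measure.restrict_mono hsub le_rfl
    rw [hEeq z hz, intervalIntegral.integral_of_le hz.2]
    have hEi : Integrable E (volume.restrict (Ioc z T)) :=
      (hEc.integrableOn_Icc (a := z) (b := T)).mono_set Ioc_subset_Icc_self
    calc ∫ t in Ioc z T, φ t ≤ ∫ t in Ioc z T, (ψ t + K * E t) := by
          refine integral_mono_ae (hφ.mono_measure hμ)
            ((hψ.mono_measure hμ).add (hEi.const_mul K)) ?_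
          filter_upwards [ae_mono hμ h, ae_restrict_mem measurableSet_Ioc] with t ht htm
          rwa [hEeq t (Ioc_subset_Icc_self (hsub htm))]
      _ = (∫ t in Ioc z T, ψ t) + K * ∫ t in Ioc z T, E t := by
          rw [integral_add (hψ.mono_measure hμ) (hEi.const_mul K), integral_const_mul]
      _ ≤ _ := by
          refine add_le_add_left (le_trans ?_ hA) _
          exact setIntegral_mono_set hψ (Filter.Eventually.of_forall hψ0) hsub.eventuallyLE
  -- The inequality for `φ` holds only almost everywhere, so it is integrated once to bound `E`. A
  -- second integration and the reflection `z = T - s` give a differentiable `F` with `F 0 = 0` and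
  -- `F' ≤ K F + A` on `[0, ρ]`, to which the classical lemma applies.
  set F : ℝ → ℝ := fun s => ∫ r in (0 : ℝ)..s, E (T - r) with hF
  have hc : Continuous fun r => E (T - r) := hEc.comp (continuous_const.sub continuous_id)
  have hFd : ∀ s, HasDerivAt F (E (T - s)) s := fun s =>
    intervalIntegral.integral_hasDerivAt_right (hc.intervalIntegrable _ _)
      (hc.stronglyMeasurableAtFilter _ _) hc.continuousAt
  have hFeq : ∀ s, F s = ∫ t in (T - s)..T, E t := fun s => by
    simp only [hF]
    rw [intervalIntegral.integral_comp_sub_left (fun t => E t) T, sub_zero]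
  have hF0 : ∀ s, 0 ≤ s → 0 ≤ F s := fun s hs =>
    intervalIntegral.integral_nonneg hs fun r hr => hE0 _ (by linarith [hr.1])
  have hbound : ∀ s ∈ Icc 0 ρ, E (T - s) ≤ K * F s + A := by
    intro s hs
    rw [hFeq, add_comm]
    exact hstep _ ⟨by linarith [hs.2], by linarith [hs.1]⟩
  have hgr := norm_le_gronwallBound_of_norm_deriv_right_le (f := F) (f' := fun s => E (T - s))
    (δ := 0) (K := K) (ε := A) (a := 0) (b := ρ)
    (fun s _ => (hFd s).continuousAt.continuousWithinAt)
    (fun s _ => (hFd s).hasDerivWithinAt) (by simp [hF])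
    (fun s hs => by
      rw [Real.norm_of_nonneg (hE0 _ (by linarith [hs.1])), Real.norm_of_nonneg (hF0 s hs.1)]
      exact hbound s (Ico_subset_Icc_self hs)) ρ (right_mem_Icc.2 hρ)
  rw [Real.norm_of_nonneg (hF0 ρ hρ), sub_zero, gronwallBound_of_K_ne_0 hK.ne'] at hgr
  have hlast := hbound ρ (right_mem_Icc.2 hρ)
  have hBT : T - ρ = B := by rw [hT]; ring
  rw [hBT, hEeq B ⟨le_rfl, by linarith⟩] at hlast
  refine hlast.trans ?_
  simp only [zero_mul, zero_add] at hgr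
  calc K * F ρ + A ≤ K * (A / K * (Real.exp (K * ρ) - 1)) + A := by gcongr
    _ = _ := by field_simp; ring

theorem ae_eq_zero_of_forall_exists_integral_lt {X : Type*} [MeasurableSpace X] {μ : Measure X}
    {g : X → ℝ} (hg : AEStronglyMeasurable g μ) (hg0 : ∀ x, 0 ≤ g x)
    (h : ∀ ε > 0, ∃ f : X → ℝ, Integrable f μ ∧ g ≤ᵐ[μ] f ∧ ∫ x, f x ∂μ < ε) :
    g =ᵐ[μ] 0 := by
  obtain ⟨f₁, hf₁, hgf₁, -⟩ := h 1 one_pos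
  have hgi : Integrable g μ := hf₁.mono' hg (hgf₁.mono fun x hx => by
    rwa [Real.norm_of_nonneg (hg0 x)])
  rw [← integral_eq_zero_iff_of_nonneg hg0 hgi]
  refine le_antisymm (le_of_forall_pos_le_add fun ε hε => ?_) (integral_nonneg hg0)
  obtain ⟨f, hf, hgf, hlt⟩ := h ε hε
  rw [zero_add]
  exact (integral_mono_ae hgi hf hgf).trans hlt.le

/-! ### The norm of `H_N^{1,h}`: equivalence with `L_2` and the triangle inequality. -/

section Norm

variable {B ρ : ℝ} {k N m : ℕ} {W U : SemiFun k N}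

theorem l2Sq_nonneg (hρ : 0 ≤ ρ) (Q : Fin m → Fin m → ℝ → EuclideanSpace ℝ (Fin N)) :
    0 ≤ l2Sq B ρ Q :=
  Finset.sum_nonneg fun _ _ => Finset.sum_nonneg fun _ _ =>
    intervalIntegral.integral_nonneg (by linarith) fun _ _ => sq_nonneg _

theorem normH1_nonneg : 0 ≤ normH1 B ρ W := Real.sqrt_nonneg _

theorem normH1_sq (hρ : 0 ≤ ρ) :
    normH1 B ρ W ^ 2 = l2Sq B ρ (dx W) + l2Sq B ρ (dy W) + l2Sq B ρ W :=
  Real.sq_sqrt (add_nonneg (add_nonneg (l2Sq_nonneg hρ _) (l2Sq_nonneg hρ _)) (l2Sq_nonneg hρ _))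

theorem MemH1.integral_gridSq_le_normH1_sq (hρ : 0 ≤ ρ) (h : MemH1 B ρ W) :
    ∫ t in Ioc B (B + ρ), gridSq (fun i j => W i j t) ≤ normH1 B ρ W ^ 2 := by
  rw [normH1_sq hρ, ← l2Sq_eq_integral_gridSq hρ h]
  linarith [l2Sq_nonneg (B := B) hρ (dx W), l2Sq_nonneg (B := B) hρ (dy W)]

theorem MemH1.integral_norm_sq_le_normH1_sq (hρ : 0 ≤ ρ) (h : MemH1 B ρ W)
    (i j : Fin (k + 1)) :
    ∫ t in Ioc B (B + ρ), ‖W i j t‖ ^ 2 ≤ normH1 B ρ W ^ 2 := by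
  have := h.integral_norm_sq_le le_rfl (C := 1) (v := W i j) fun t => by
    rw [one_mul]; exact norm_sq_le_gridSq (fun i j => W i j t) i j
  rw [one_mul] at this
  exact this.trans (h.integral_gridSq_le_normH1_sq hρ)

/-- The squared norm of `H_N^{1,h}` is at most `normBound k` times the squared norm of `L_2`. -/
def normBound (k : ℕ) : ℝ := 2 * ((k - 1 : ℕ) : ℝ) ^ 2 * diffBound k + 1

theorem normBound_pos (k : ℕ) : 0 < normBound k := by
  have := diffBound_nonneg k
  unfold normBound
  positivity

/-- There are `2 (k - 1)²` differences, each bounded through the nodal values since the step is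
fixed. -/
theorem MemH1.normH1_sq_le (hρ : 0 ≤ ρ) (h : MemH1 B ρ W) :
    normH1 B ρ W ^ 2 ≤ normBound k * ∫ t in Ioc B (B + ρ), gridSq (fun i j => W i j t) := by
  have key : ∀ Q : Fin (k - 1) → Fin (k - 1) → ℝ → EuclideanSpace ℝ (Fin N),
      (∀ i j t, ‖Q i j t‖ ^ 2 ≤ diffBound k * gridSq fun i j => W i j t) →
      l2Sq B ρ Q ≤ ((k - 1 : ℕ) : ℝ) ^ 2 *
        (diffBound k * ∫ t in Ioc B (B + ρ), gridSq (fun i j => W i j t)) := by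
    intro Q hQ
    calc l2Sq B ρ Q ≤ ∑ _i : Fin (k - 1), ∑ _j : Fin (k - 1),
          (diffBound k * ∫ t in Ioc B (B + ρ), gridSq (fun i j => W i j t)) := by
          refine Finset.sum_le_sum fun i _ => Finset.sum_le_sum fun j _ => ?_
          rw [intervalIntegral.integral_of_le (by linarith)]
          exact h.integral_norm_sq_le le_rfl (hQ i j)
      _ = _ := by simp; ring
  have hx := key (dx W) fun i j t => norm_dx_sq_le (fun i j => W i j t) i j
  have hy := key (dy W) fun i j t => norm_dy_sq_le (fun i j => W i j t) i j
  rw [normH1_sq hρ, l2Sq_eq_integral_gridSq hρ h, normBound]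
  linarith

/-- Young's inequality with weights chosen so that the right side is exactly `(p + q)²` when `‖x‖ =
p` and `‖y‖ = q`. Being linear in the squares, it can be summed and integrated to give
`normH1_add_le`. -/
theorem norm_add_sq_le_of_pos {V : Type*} [NormedAddCommGroup V] {p q : ℝ} (hp : 0 < p)
    (hq : 0 < q) (x y : V) :
    ‖x + y‖ ^ 2 ≤ (p + q) / p * ‖x‖ ^ 2 + (p + q) / q * ‖y‖ ^ 2 := by
  refine (pow_le_pow_left₀ (norm_nonneg _) (norm_add_le x y) 2).trans ?_
  have : (p + q) / p * ‖x‖ ^ 2 + (p + q) / q * ‖y‖ ^ 2 - (‖x‖ + ‖y‖) ^ 2 =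
      (q * ‖x‖ - p * ‖y‖) ^ 2 / (p * q) := by
    field_simp; ring
  have h0 : 0 ≤ (q * ‖x‖ - p * ‖y‖) ^ 2 / (p * q) := by positivity
  linarith

theorem l2Sq_add_le (hρ : 0 ≤ ρ) {p q : ℝ} (hp : 0 < p) (hq : 0 < q)
    {Q Q' : Fin m → Fin m → ℝ → EuclideanSpace ℝ (Fin N)}
    (hQ : ∀ i j, MemLp (Q i j) 2 (volume.restrict (Ioc B (B + ρ))))
    (hQ' : ∀ i j, MemLp (Q' i j) 2 (volume.restrict (Ioc B (B + ρ)))) :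
    l2Sq B ρ (Q + Q') ≤ (p + q) / p * l2Sq B ρ Q + (p + q) / q * l2Sq B ρ Q' := by
  simp only [l2Sq, Finset.mul_sum, ← Finset.sum_add_distrib]
  refine Finset.sum_le_sum fun i _ => Finset.sum_le_sum fun j _ => ?_
  simp only [intervalIntegral.integral_of_le (by linarith : B ≤ B + ρ)]
  have h1 := (hQ i j).norm.integrable_sq.const_mul ((p + q) / p)
  have h2 := (hQ' i j).norm.integrable_sq.const_mul ((p + q) / q)
  rw [← integral_const_mul, ← integral_const_mul, ← integral_add h1 h2]
  exact integral_mono_of_nonneg (Filter.Eventually.of_forall fun t => sq_nonneg _) (h1.add h2)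
    (Filter.Eventually.of_forall fun t => norm_add_sq_le_of_pos hp hq _ _)

theorem normH1_add_le (hρ : 0 ≤ ρ) (hW : MemH1 B ρ W) (hU : MemH1 B ρ U) {p q : ℝ} (hp : 0 < p)
    (hq : 0 < q) (hWp : normH1 B ρ W ≤ p) (hUq : normH1 B ρ U ≤ q) :
    normH1 B ρ (W + U) ≤ p + q := by
  have ex : dx (W + U) = dx W + dx U := by
    funext i j; simp only [dx, Pi.add_apply, ← smul_add]; congr 1; abel
  have ey : dy (W + U) = dy W + dy U := by
    funext i j; simp only [dy, Pi.add_apply, ← smul_add]; congr 1; abel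
  have h1 := l2Sq_add_le hρ hp hq hW.memLp_dx hU.memLp_dx
  have h2 := l2Sq_add_le hρ hp hq hW.memLp_dy hU.memLp_dy
  have h3 := l2Sq_add_le hρ hp hq (memH1_iff.1 hW) (memH1_iff.1 hU)
  have hsq : normH1 B ρ (W + U) ^ 2 ≤
      (p + q) / p * normH1 B ρ W ^ 2 + (p + q) / q * normH1 B ρ U ^ 2 := by
    rw [normH1_sq hρ, normH1_sq hρ, normH1_sq hρ, ex, ey]
    linarith
  refine abs_le_of_sq_le_sq' (hsq.trans ?_) (by positivity) |>.2
  calc _ ≤ (p + q) / p * p ^ 2 + (p + q) / q * q ^ 2 := by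
        have := normH1_nonneg (B := B) (ρ := ρ) (W := W)
        have := normH1_nonneg (B := B) (ρ := ρ) (W := U)
        gcongr
    _ = _ := by field_simp

end Norm

/-! ### Constraints that survive the closure, and the competitor. -/

section Closure

variable {a b B ρ c₀ R : ℝ} {k N : ℕ} {W F Gt : SemiFun k N}

theorem admissibleFun_of_mem_setK (hρ : 0 ≤ ρ) (hR : 0 < R) (h : W ∈ setK a b B ρ c₀ Gt R) :
    AdmissibleFun a b B ρ c₀ (4 * R ^ 2) W := by
  refine ⟨h.1, fun i j => ?_, ?_⟩
  · filter_upwards [ae_restrict_mem measurableSet_Ioc] with t ht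
    exact h.2.1 i j t (Ioc_subset_Icc_self ht)
  · refine (h.1.integral_gridSq_le_normH1_sq hρ).trans ?_
    have := h.2.2.2
    have h0 := normH1_nonneg (B := B) (ρ := ρ) (W := W)
    nlinarith

/-- The admissible coefficient vectors form a closed set `A`. The distance of `W` to `A` is at most
`‖W - V‖` for approximants `V`, hence vanishes almost everywhere. The norm bound is the crude `R +
R`. -/
theorem admissibleFun_of_mem_closureH1 (hρ : 0 ≤ ρ) (hR : 0 < R)
    (h : W ∈ closureH1 B ρ (setK a b B ρ c₀ Gt R)) :
    AdmissibleFun a b B ρ c₀ (4 * R ^ 2) W := by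
  obtain ⟨hW, hap⟩ := h
  refine ⟨hW, fun i j => ?_, ?_⟩
  · set A : Set (EuclideanSpace ℝ (Fin N)) := {w | ∀ α ∈ Icc a b, c₀ ^ 2 ≤ series a b w α} with hA
    have hAc : IsClosed A := by
      have : A = ⋂ α ∈ Icc a b, {w | c₀ ^ 2 ≤ series a b w α} := by ext; simp [hA]
      rw [this]
      exact isClosed_biInter fun α _ =>
        isClosed_le continuous_const (continuous_series_left a b α)
    have hAne : A.Nonempty := by
      obtain ⟨V, hV, -⟩ := hap 1 one_pos
      exact ⟨V i j B, hV.2.1 i j B ⟨le_rfl, by linarith⟩⟩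
    have hz : (fun t => Metric.infDist (W i j t) A ^ 2)
        =ᵐ[volume.restrict (Ioc B (B + ρ))] 0 := by
      refine ae_eq_zero_of_forall_exists_integral_lt ?_ (fun _ => sq_nonneg _) fun ε hε => ?_
      · exact ((Metric.continuous_infDist_pt A).pow 2).comp_aestronglyMeasurable
          (memH1_iff.1 hW i j).1
      · obtain ⟨V, hV, hlt⟩ := hap (√ε) (Real.sqrt_pos.2 hε)
        have hsub := hW.sub hV.1
        refine ⟨fun t => ‖(W - V) i j t‖ ^ 2, (memH1_iff.1 hsub i j).norm.integrable_sq, ?_, ?_⟩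
        · filter_upwards [ae_restrict_mem measurableSet_Ioc] with t ht
          refine pow_le_pow_left₀ Metric.infDist_nonneg ?_ 2
          refine (Metric.infDist_le_dist_of_mem (y := V i j t) ?_).trans (le_of_eq ?_)
          · exact hV.2.1 i j t (Ioc_subset_Icc_self ht)
          · rw [dist_eq_norm]; rfl
        · refine (hsub.integral_norm_sq_le_normH1_sq hρ i j).trans_lt ?_
          calc _ < √ε ^ 2 := pow_lt_pow_left₀ hlt normH1_nonneg two_ne_zero
            _ = ε := Real.sq_sqrt hε.le
    filter_upwards [hz] with t ht
    have h0 : Metric.infDist (W i j t) A = 0 := by simpa using ht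
    exact (hAc.mem_iff_infDist_zero hAne).2 h0
  · obtain ⟨V, hV, hlt⟩ := hap R hR
    have := normH1_add_le hρ hV.1 (hW.sub hV.1) hR hR hV.2.2.2.le hlt.le
    rw [add_sub_cancel] at this
    refine (hW.integral_gridSq_le_normH1_sq hρ).trans ?_
    calc _ ≤ (R + R) ^ 2 := pow_le_pow_left₀ normH1_nonneg this 2
      _ = _ := by ring

/-- Every approximant equals `F` at lateral nodes, so there `W - F = W - V` is arbitrarily small in
`L_2`. The condition at `z = B` lives on a null set and is not controlled by the norm. -/
theorem ae_eq_of_mem_closureH1 (hρ : 0 ≤ ρ) (hF : MemH1 B ρ F) (hFG : AgreeOnBoundary B ρ F Gt)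
    (h : W ∈ closureH1 B ρ (setK a b B ρ c₀ Gt R)) {i j : Fin (k + 1)} (hij : IsEnd i ∨ IsEnd j) :
    ∀ᵐ t ∂volume.restrict (Ioc B (B + ρ)), W i j t = F i j t := by
  obtain ⟨hW, hap⟩ := h
  have hz : (fun t => ‖(W - F) i j t‖ ^ 2) =ᵐ[volume.restrict (Ioc B (B + ρ))] 0 := by
    refine ae_eq_zero_of_forall_exists_integral_lt
      (memH1_iff.1 (hW.sub hF) i j).norm.integrable_sq.1 (fun _ => sq_nonneg _) fun ε hε => ?_
    obtain ⟨V, hV, hlt⟩ := hap (√ε) (Real.sqrt_pos.2 hε)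
    have hsub := hW.sub hV.1
    refine ⟨fun t => ‖(W - V) i j t‖ ^ 2, (memH1_iff.1 hsub i j).norm.integrable_sq, ?_, ?_⟩
    · filter_upwards [ae_restrict_mem measurableSet_Ioc] with t ht
      have hor : IsEnd i ∨ IsEnd j ∨ t = B := hij.imp_right Or.inl
      simp only [Pi.sub_apply]
      rw [hFG i j t (Ioc_subset_Icc_self ht) hor, hV.2.2.1 i j t (Ioc_subset_Icc_self ht) hor]
    · refine (hsub.integral_norm_sq_le_normH1_sq hρ i j).trans_lt ?_
      calc _ < √ε ^ 2 := pow_lt_pow_left₀ hlt normH1_nonneg two_ne_zero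
        _ = ε := Real.sq_sqrt hε.le
  filter_upwards [hz] with t ht
  have h0 : (W - F) i j t = 0 := by simpa using ht
  exact sub_eq_zero.1 h0

theorem subset_closureH1 {S : Set (SemiFun k N)} (hS : ∀ V ∈ S, MemH1 B ρ V) :
    S ⊆ closureH1 B ρ S := by
  refine fun V hV => ⟨hS V hV, fun ε hε => ⟨V, hV, ?_⟩⟩
  simpa [normH1, l2Sq, dx, dy] using hε

open Classical in
/-- The function with the values of `F` on `Γ^h ∪ D_B^h` and those of `W` elsewhere. -/
def glue (B : ℝ) (F W : SemiFun k N) : SemiFun k N := fun i j t =>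
  if IsEnd i ∨ IsEnd j ∨ t = B then F i j t else W i j t

/-- At interior nodes the gluing changes `W` only at `z = B`, a null set. -/
theorem memH1_glue (hF : MemH1 B ρ F) (hW : MemH1 B ρ W) : MemH1 B ρ (glue B F W) := by
  rw [memH1_iff] at *
  intro i j
  by_cases hij : IsEnd i ∨ IsEnd j
  · have : glue B F W i j = F i j := by
      funext t; rw [glue, if_pos (hij.imp_right Or.inl)]
    rw [this]; exact hF i j
  · refine (hW i j).ae_eq ?_
    filter_upwards [ae_restrict_mem measurableSet_Ioc] with t ht
    rw [glue, if_neg]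
    rintro (h | h | h)
    · exact hij (Or.inl h)
    · exact hij (Or.inr h)
    · exact ht.1.ne' h

/-- The element `X` shows that the boundary data are themselves compatible with `u ≥ c₀²`: on the
boundary `F` equals `X`. -/
theorem glue_mem_setK {Gts X : SemiFun k N} {R' : ℝ} (hF : MemH1 B ρ F)
    (hFG : AgreeOnBoundary B ρ F Gt) (hW : W ∈ setK a b B ρ c₀ Gts R')
    (hX : X ∈ setK a b B ρ c₀ Gt R) (hnorm : normH1 B ρ (glue B F W) < R) :
    glue B F W ∈ setK a b B ρ c₀ Gt R := by
  refine ⟨memH1_glue hF hW.1, fun i j z hz α hα => ?_, fun i j z hz h => ?_, hnorm⟩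
  · rw [glue]
    split_ifs with h
    · rw [hFG i j z hz h, ← hX.2.2.1 i j z hz h]
      exact hX.2.1 i j z hz α hα
    · exact hW.2.1 i j z hz α hα
  · rw [glue, if_pos h, hFG i j z hz h]

theorem gridSq_glue_sub_le {Gts Fs : SemiFun k N} (hWG : AgreeOnBoundary B ρ W Gts)
    (hFsG : AgreeOnBoundary B ρ Fs Gts) {t : ℝ} (ht : t ∈ Icc B (B + ρ)) :
    gridSq (fun i j => (glue B F W - W) i j t) ≤ gridSq fun i j => (F - Fs) i j t := by
  refine Finset.sum_le_sum fun i _ => Finset.sum_le_sum fun j _ => ?_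
  simp only [Pi.sub_apply, glue]
  split_ifs with h
  · rw [hWG i j t ht h, hFsG i j t ht h]
  · simp

end Closure

/-! ### Splitting the nodes into boundary and interior ones; data norms by Parseval. -/

theorem isEnd_or_eq_mid {k : ℕ} (hk : 2 ≤ k) (i : Fin (k + 1)) :
    IsEnd i ∨ ∃ i' : Fin (k - 1), i = mid i' := by
  by_cases h0 : i = 0
  · exact Or.inl (Or.inl h0)
  by_cases hl : i = Fin.last k
  · exact Or.inl (Or.inr hl)
  have h1 : (i : ℕ) ≠ 0 := fun h => h0 (Fin.ext h)
  have h2 : (i : ℕ) ≠ k := fun h => hl (Fin.ext h)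
  have h3 := i.2
  exact Or.inr ⟨⟨i - 1, by omega⟩, Fin.ext (by simp only [mid]; omega)⟩

theorem not_isEnd_mid {k : ℕ} (i : Fin (k - 1)) : ¬ IsEnd (mid i) := by
  have := i.2
  rintro (h | h)
  · simpa [mid] using congrArg Fin.val h
  · have := congrArg Fin.val h
    simp only [mid, Fin.val_last] at this
    omega

theorem gridSq_le_add_interior {k : ℕ} (hk : 2 ≤ k) {V : Type*} [NormedAddCommGroup V]
    (Q Q' : Fin (k + 1) → Fin (k + 1) → V)
    (h : ∀ i j, IsEnd i ∨ IsEnd j → Q i j = Q' i j) :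
    gridSq Q ≤ gridSq Q' +
      ((k : ℝ) + 1) ^ 2 * gridSq fun i j : Fin (k - 1) => Q (mid i) (mid j) := by
  have key : ∀ i j, ‖Q i j‖ ^ 2 ≤
      ‖Q' i j‖ ^ 2 + gridSq fun i j : Fin (k - 1) => Q (mid i) (mid j) := by
    intro i j
    by_cases hij : IsEnd i ∨ IsEnd j
    · rw [h i j hij]
      exact le_add_of_nonneg_right (gridSq_nonneg _)
    · obtain ⟨i', rfl⟩ := (isEnd_or_eq_mid hk i).resolve_left fun h => hij (Or.inl h)
      obtain ⟨j', rfl⟩ := (isEnd_or_eq_mid hk j).resolve_left fun h => hij (Or.inr h)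
      exact (norm_sq_le_gridSq (fun i j : Fin (k - 1) => Q (mid i) (mid j)) i' j').trans
        (le_add_of_nonneg_left (sq_nonneg _))
  refine (Finset.sum_le_sum fun i _ => Finset.sum_le_sum fun j _ => key i j).trans (le_of_eq ?_)
  simp only [Finset.sum_add_distrib, Finset.sum_const, Finset.card_univ, Fintype.card_fin,
    nsmul_eq_mul, gridSq]
  push_cast
  ring

theorem gridSq_eq_normGrid_sq {a b : ℝ} (hab : a < b) {k N : ℕ}
    (G : Fin (k + 1) → Fin (k + 1) → EuclideanSpace ℝ (Fin N)) :
    gridSq G = normGrid a b (fun i j α => series a b (G i j) α) ^ 2 := by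
  have : ∑ i, ∑ j, ∫ α in a..b, series a b (G i j) α ^ 2 = gridSq G := by
    simp only [integral_series_sq hab, gridSq]
  rw [normGrid, this, Real.sq_sqrt (gridSq_nonneg G)]

end TravelTime

end

/-! ### The functional and the conditional stability estimate. -/

noncomputable section

namespace TravelTime

open MeasureTheory Set

theorem norm_toLp_sq_le {N : ℕ} {f : Fin N → ℝ} {e : ℝ} (h : ∀ n, f n ^ 2 ≤ e) :
    ‖(WithLp.toLp 2 f : EuclideanSpace ℝ (Fin N))‖ ^ 2 ≤ N * e := by
  rw [EuclideanSpace.real_norm_sq_eq]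
  refine (Finset.sum_le_sum fun n _ => h n).trans (le_of_eq ?_)
  simp

/-- If the residual of `V` is small pointwise, so is the functional. -/
theorem costJ_le {s : ℕ} {a b B ρ lam e : ℝ} {k N : ℕ} (hρ : 0 ≤ ρ) (hlam : 0 < lam)
    {G : Fin (k + 1) → Fin (k + 1) → EuclideanSpace ℝ (Fin N)} {V : SemiFun k N}
    (h : ∀ i j, ∀ z ∈ Ioo B (B + ρ), ‖residual s a b B ρ G V i j z‖ ^ 2 ≤ e) :
    costJ s a b B ρ lam G V ≤
      ((k - 1 : ℕ) : ℝ) ^ 2 * (Real.exp (lam * (B + ρ)) ^ 2 * ρ) * e := by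
  calc costJ s a b B ρ lam G V ≤ ∑ _i : Fin (k - 1), ∑ _j : Fin (k - 1),
        Real.exp (lam * (B + ρ)) ^ 2 * e * |B + ρ - B| := by
        simp only [costJ, l2Sq]
        refine Finset.sum_le_sum fun i _ => Finset.sum_le_sum fun j _ => ?_
        refine (Real.le_norm_self _).trans (intervalIntegral.norm_integral_le_of_norm_le_const_ae ?_)
        -- The residual bound is given on the open interval only; the end point is a null set.
        have hne : ∀ᵐ z : ℝ, z ≠ B + ρ := by simp [ae_iff]
        filter_upwards [hne] with z hz hzm
        rw [uIoc_of_le (by linarith)] at hzm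
        rw [Real.norm_of_nonneg (sq_nonneg _), norm_smul, mul_pow,
          Real.norm_of_nonneg (Real.exp_pos _).le]
        have := h i j z ⟨hzm.1, lt_of_le_of_ne hzm.2 hz⟩
        have hz' : z ≤ B + ρ := hzm.2
        gcongr
    _ = _ := by simp [abs_of_nonneg hρ]; ring

/-- For `z > B > 0` and `λ > 0` the Carleman weight is at least `1`. -/
theorem integral_gridSq_residual_le_costJ {s : ℕ} (hs : s ≤ 1) {a b B ρ c₀ D lam : ℝ} {k N : ℕ}
    (hab : a < b) (hB : 0 < B) (hρ : 0 < ρ) (hc₀ : 0 < c₀) (hlam : 0 < lam)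
    (G : Fin (k + 1) → Fin (k + 1) → EuclideanSpace ℝ (Fin N)) {W : SemiFun k N}
    (h : AdmissibleFun a b B ρ c₀ D W) :
    ∫ z in Ioc B (B + ρ), gridSq (fun i j => residual s a b B ρ G W i j z) ≤
      costJ s a b B ρ lam G W := by
  have hi := fun i j => (h.integrable_norm_residual_sq hs hab hρ hc₀ G i j)
  simp only [gridSq]
  rw [integral_finsetSum _ fun i _ => integrable_finsetSum _ fun j _ => (hi i j).2]
  simp only [integral_finsetSum _ fun j _ => (hi _ j).2, costJ, l2Sq]
  refine Finset.sum_le_sum fun i _ => Finset.sum_le_sum fun j _ => ?_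
  rw [intervalIntegral.integral_of_le (by linarith)]
  have hw : ∀ z, ‖Real.exp (lam * z) • residual s a b B ρ G W i j z‖ ^ 2 =
      Real.exp (lam * z) ^ 2 * ‖residual s a b B ρ G W i j z‖ ^ 2 := fun z => by
    rw [norm_smul, mul_pow, Real.norm_of_nonneg (Real.exp_pos _).le]
  simp only [hw]
  refine integral_mono_ae (hi i j).2 ?_ ?_
  · refine (hi i j).2.bdd_mul (c := Real.exp (lam * (B + ρ)) ^ 2)
      (by fun_prop : Continuous fun z => Real.exp (lam * z) ^ 2).aestronglyMeasurable ?_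
    filter_upwards [ae_restrict_mem measurableSet_Ioc] with z hz
    rw [Real.norm_of_nonneg (sq_nonneg _)]
    have hz' : z ≤ B + ρ := hz.2
    gcongr
  · filter_upwards [ae_restrict_mem measurableSet_Ioc] with z hz
    have h1 : 1 ≤ Real.exp (lam * z) := Real.one_le_exp (by nlinarith [hz.1])
    exact le_mul_of_one_le_left (sq_nonneg _) (one_le_pow₀ h1)

/-- The conditional stability estimate: two admissible functions are close if the residual of the
first one, the difference of their lateral boundary values, and that of the data are small. -/
theorem exists_integral_gridSq_sub_le {s : ℕ} (hs : s ≤ 1) {a b B ρ c₀ D : ℝ} (q e₀ : ℝ)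
    {k N : ℕ} (hab : a < b) (hρ : 0 < ρ) (hc₀ : 0 < c₀) (hD : 0 ≤ D) (hk : 2 ≤ k)
    (he₀ : 0 ≤ e₀) :
    ∃ C > 0, ∀ (G Gs : Fin (k + 1) → Fin (k + 1) → EuclideanSpace ℝ (Fin N))
      (W Ws U : SemiFun k N) (δ : ℝ), AdmissibleFun a b B ρ c₀ D W →
      AdmissibleFun a b B ρ c₀ D Ws → MemH1 B ρ U → gridSq G ≤ q → gridSq Gs ≤ q →
      (∀ i j, ∀ z ∈ Ioo B (B + ρ), residual s a b B ρ Gs Ws i j z = 0) →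
      gridSq (G - Gs) ≤ δ ^ 2 →
      (∀ i j, IsEnd i ∨ IsEnd j →
        ∀ᵐ t ∂volume.restrict (Ioc B (B + ρ)), (W - Ws) i j t = U i j t) →
      ∫ t in Ioc B (B + ρ), gridSq (fun i j => U i j t) ≤ δ ^ 2 →
      ∫ z in Ioc B (B + ρ), gridSq (fun i j => residual s a b B ρ G W i j z) ≤ e₀ * δ ^ 2 →
      ∫ t in Ioc B (B + ρ), gridSq (fun i j => (W - Ws) i j t) ≤ C * δ ^ 2 := by
  obtain ⟨L, hL, hLip⟩ := exists_sq_opP_sub_le hs q k N hab hρ hc₀ hD (B := B)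
  obtain ⟨M, hM, hMb⟩ := exists_norm_le_matM hab N
  set κ : ℝ := ((k : ℝ) + 1) ^ 2 * (2 * M ^ 2) with hκ
  have hκ0 : 0 ≤ κ := by positivity
  set K : ℝ := κ * (((k - 1 : ℕ) : ℝ) ^ 2 * (N * L)) with hK
  have hK0 : 0 ≤ K := by positivity
  -- The three terms come from the lateral values `U`, the residual, and the data error integrated
  -- over a length `ρ`. The rate is `K + 1` because Gronwall needs it positive, while `K` may
  -- vanish.
  refine ⟨(1 + κ * e₀ + K * ρ) * Real.exp ((K + 1) * ρ), by positivity, ?_⟩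
  intro G Gs W Ws U δ hW hWs hU hG hGs hres hGG hbd hUi hRi
  have hsub := hW.memH1.sub hWs.memH1
  have hRint : Integrable (fun z => gridSq fun i j => residual s a b B ρ G W i j z)
      (volume.restrict (Ioc B (B + ρ))) :=
    integrable_finsetSum _ fun i _ => integrable_finsetSum _ fun j _ =>
      (hW.integrable_norm_residual_sq hs hab hρ hc₀ G i j).2
  set ψ : ℝ → ℝ := fun z => gridSq (fun i j => U i j z) +
    κ * gridSq (fun i j => residual s a b B ρ G W i j z) + K * δ ^ 2 with hψ
  have hψ1 : Integrable (fun z => gridSq (fun i j => U i j z) +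
      κ * gridSq (fun i j => residual s a b B ρ G W i j z))
      (volume.restrict (Ioc B (B + ρ))) := hU.integrable_gridSq.add (hRint.const_mul κ)
  have hψi : Integrable ψ (volume.restrict (Ioc B (B + ρ))) := hψ1.add (integrable_const _)
  have hψint : ∫ z in Ioc B (B + ρ), ψ z ≤ (1 + κ * e₀ + K * ρ) * δ ^ 2 := by
    have e1 : ∫ z in Ioc B (B + ρ), ψ z = (∫ z in Ioc B (B + ρ), gridSq (fun i j => U i j z)) +
        κ * (∫ z in Ioc B (B + ρ), gridSq (fun i j => residual s a b B ρ G W i j z)) +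
        ρ * (K * δ ^ 2) := by
      rw [hψ, integral_add hψ1 (integrable_const _), integral_add hU.integrable_gridSq
        (hRint.const_mul κ), integral_const_mul]
      simp [hρ.le]
    rw [e1]
    nlinarith [mul_le_mul_of_nonneg_left hRi hκ0]
  have hfin := integral_le_of_ae_le_add_integral (K := K + 1) hρ.le (by positivity)
    (fun t => gridSq_nonneg fun i j => (W - Ws) i j t)
    (fun z => by
      have h1 := gridSq_nonneg fun i j => U i j z
      have h2 := gridSq_nonneg fun i j => residual s a b B ρ G W i j z
      positivity : ∀ z, 0 ≤ ψ z)
    hsub.integrable_gridSq hψi hψint ?_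
  · exact hfin.trans (le_of_eq (by ring))
  have hbd' : ∀ᵐ t ∂volume.restrict (Ioc B (B + ρ)), ∀ i j, IsEnd i ∨ IsEnd j →
      (W - Ws) i j t = U i j t := by
    refine ae_all_iff.2 fun i => ae_all_iff.2 fun j => ?_
    by_cases hij : IsEnd i ∨ IsEnd j
    · filter_upwards [hbd i j hij] with t ht _ using ht
    · exact Filter.Eventually.of_forall fun t h => absurd h hij
  have hne : ∀ᵐ z ∂volume.restrict (Ioc B (B + ρ)), z ≠ B + ρ :=
    ae_restrict_of_ae (by simp [ae_iff])
  filter_upwards [hbd', hne, ae_restrict_mem measurableSet_Ioc] with z hz hzne hzm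
  set X := ∫ t in Ioc z (B + ρ), gridSq (fun i j => (W - Ws) i j t) with hX
  have hX0 : 0 ≤ X := integral_gridSq_nonneg _ _ _
  have hint : ∀ i j : Fin (k - 1), ‖(W - Ws) (mid i) (mid j) z‖ ^ 2 ≤
      2 * M ^ 2 * (‖residual s a b B ρ G W i j z‖ ^ 2 + N * (L * (X + δ ^ 2))) := by
    intro i j
    have hzo : z ∈ Ioo B (B + ρ) := ⟨hzm.1, lt_of_le_of_ne hzm.2 hzne⟩
    -- The exact equation removes the second residual, so `M_N (W - Ws)` is the residual of `W`
    -- minus the increment of `P`.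
    have e1 := residual_sub_residual s a b B ρ G Gs W Ws i j z
    rw [hres i j z hzo, sub_zero] at e1
    have hP := norm_toLp_sq_le fun n => (hLip G Gs W Ws hW hWs hG hGs z
      (Ioc_subset_Icc_self hzm) n i j).trans
      (mul_le_mul_of_nonneg_left (add_le_add_right hGG X) hL)
    have hMe := hMb ((W - Ws) (mid i) (mid j) z)
    have e2 : (WithLp.toLp 2 fun n => ∑ m : Fin N, matM a b N n m *
        ((W - Ws) (mid i) (mid j) z) m : EuclideanSpace ℝ (Fin N)) =
        residual s a b B ρ G W i j z -
        WithLp.toLp 2 (fun n => opP s a b B ρ G W n i j z - opP s a b B ρ Gs Ws n i j z) := by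
      rw [e1, add_sub_cancel_right]; rfl
    rw [e2] at hMe
    set r := residual s a b B ρ G W i j z
    set p : EuclideanSpace ℝ (Fin N) :=
      WithLp.toLp 2 (fun n => opP s a b B ρ G W n i j z - opP s a b B ρ Gs Ws n i j z)
    calc _ ≤ (M * ‖r - p‖) ^ 2 := pow_le_pow_left₀ (norm_nonneg _) hMe 2
      _ ≤ (M * (‖r‖ + ‖p‖)) ^ 2 := by gcongr; exact norm_sub_le r p
      _ ≤ 2 * M ^ 2 * (‖r‖ ^ 2 + ‖p‖ ^ 2) := by
          nlinarith [sq_nonneg (M * ‖r‖ - M * ‖p‖)]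
      _ ≤ _ := by gcongr
  have hsum : gridSq (fun i j : Fin (k - 1) => (W - Ws) (mid i) (mid j) z) ≤
      2 * M ^ 2 * (gridSq (fun i j => residual s a b B ρ G W i j z) +
        ((k - 1 : ℕ) : ℝ) ^ 2 * (N * (L * (X + δ ^ 2)))) := by
    refine (Finset.sum_le_sum fun i _ => Finset.sum_le_sum fun j _ => hint i j).trans
      (le_of_eq ?_)
    simp only [← Finset.mul_sum, Finset.sum_add_distrib, Finset.sum_const, Finset.card_univ,
      Fintype.card_fin, nsmul_eq_mul, gridSq]
    ring
  refine (gridSq_le_add_interior hk _ _ hz).trans ?_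
  have := mul_le_mul_of_nonneg_left hsum (by positivity : 0 ≤ ((k : ℝ) + 1) ^ 2)
  simp only [hψ]
  have e3 : ((k : ℝ) + 1) ^ 2 * (2 * M ^ 2 * (gridSq (fun i j => residual s a b B ρ G W i j z) +
        ((k - 1 : ℕ) : ℝ) ^ 2 * (N * (L * (X + δ ^ 2))))) =
      κ * gridSq (fun i j => residual s a b B ρ G W i j z) + K * X + K * δ ^ 2 := by
    rw [hK, hκ]; ring
  linarith

end TravelTime

end

/-! ### The theorem: comparing the minimizer with the glued competitor. -/

open MeasureTheory Set TravelTime in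
theorem theorem3p3
    (s : ℕ) (hs : s ≤ 1)
    (a b B ρ c₀ R γ lam : ℝ) (k N : ℕ)
    (hab : a < b) (hB : 0 < B) (hρ : 0 < ρ) (hc₀ : 0 < c₀) (hR : 0 < R)
    (hlam : 0 < lam) (hk : 2 ≤ k) (hN : 1 ≤ N) :
    ∃ C > 0,
      ∀ (G Gs : Fin (k + 1) → Fin (k + 1) → EuclideanSpace ℝ (Fin N))
        (Gt Gts F Fs Ws Wmin : TravelTime.SemiFun k N) (δ κ : ℝ),
        0 < δ → δ < 1 →
        TravelTime.normGrid a b (fun i j α => TravelTime.series a b (G i j) α) ≤ γ →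
        -- the exact solution `Ws` of the boundary value problem with the noiseless data `Gs`, `Gts`
        Ws ∈ TravelTime.setK a b B ρ c₀ Gts R →
        (∀ i j, ∀ z ∈ Set.Ioo B (B + ρ), TravelTime.residual s a b B ρ Gs Ws i j z = 0) →
        -- the noise level of the data on the upper side
        TravelTime.normGrid a b (fun i j α =>
            TravelTime.series a b (G i j) α - TravelTime.series a b (Gs i j) α) +
          TravelTime.normGrid a b (fun i j => deriv (fun α =>
            TravelTime.series a b (G i j) α - TravelTime.series a b (Gs i j) α)) < δ →
        -- the extensions of the boundary data
        TravelTime.MemH1 B ρ F → TravelTime.MemH1 B ρ Fs →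
        TravelTime.AgreeOnBoundary B ρ F Gt → TravelTime.AgreeOnBoundary B ρ Fs Gts →
        TravelTime.normH1 B ρ (F - Fs) < δ →
        TravelTime.normH1 B ρ F < R → TravelTime.normH1 B ρ Fs < R →
        -- the margin `κ`
        0 < κ → κ < R → TravelTime.normH1 B ρ Ws < R - κ → C * δ < κ →
        -- the minimizer
        Wmin ∈ TravelTime.closureH1 B ρ (TravelTime.setK a b B ρ c₀ Gt R) →
        IsMinOn (TravelTime.costJ s a b B ρ lam G)
          (TravelTime.closureH1 B ρ (TravelTime.setK a b B ρ c₀ Gt R)) Wmin →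
        TravelTime.normH1 B ρ (Wmin - Ws) ≤ C * δ := by
  -- Elements of the closure have norm at most `2 * R`.
  obtain ⟨D, hD⟩ : ∃ D, D = 4 * R ^ 2 := ⟨_, rfl⟩
  -- From `|G*|² ≤ 2 |G|² + 2 |G - G*|²` and `δ < 1`.
  obtain ⟨q, hq⟩ : ∃ q, q = 2 * γ ^ 2 + 2 := ⟨_, rfl⟩
  have hD0 : 0 ≤ D := by rw [hD]; positivity
  obtain ⟨L, hL, hLip⟩ := exists_sq_opP_sub_le hs q k N hab hρ hc₀ hD0 (B := B)
  -- This is the bound of `costJ_le` for the competitor, divided by `δ²`. The last `2` collects its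
  -- `L_2` distance to `Ws` and the data error, each at most `δ²` when squared.
  obtain ⟨e₀, he₀⟩ : ∃ e₀, e₀ =
    ((k - 1 : ℕ) : ℝ) ^ 2 * (Real.exp (lam * (B + ρ)) ^ 2 * ρ) * (N * (L * 2)) := ⟨_, rfl⟩
  obtain ⟨C₁, hC₁, hstab⟩ := exists_integral_gridSq_sub_le hs q e₀ (k := k) (N := N) (B := B)
    hab hρ hc₀ hD0 hk (by rw [he₀]; positivity)
  have hnb := normBound_pos k
  -- The first summand bounds the distance from the competitor to `Ws`, so `C * δ < κ` keeps its
  -- norm below `R`; the second is the stability constant.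
  refine ⟨√(normBound k) + √(normBound k * C₁), by positivity, ?_⟩
  intro G Gs Gt Gts F Fs Ws Wmin δ κ hδ hδ1 hGγ hWs hres hnoise hF hFs hFG hFsG hFF _ _ hκ hκR
    hWsκ hCδ hWmin hmin
  have hGG : gridSq (G - Gs) ≤ δ ^ 2 := by
    rw [gridSq_eq_normGrid_sq hab]
    simp only [Pi.sub_apply, series_sub]
    have h1 : 0 ≤ normGrid a b (fun i j α => series a b (G i j) α - series a b (Gs i j) α) :=
      Real.sqrt_nonneg _
    have h2 : 0 ≤ normGrid a b (fun i j => deriv fun α =>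
      series a b (G i j) α - series a b (Gs i j) α) := Real.sqrt_nonneg _
    exact pow_le_pow_left₀ h1 (by linarith) 2
  have hGle : gridSq G ≤ γ ^ 2 := by
    rw [gridSq_eq_normGrid_sq hab]
    exact pow_le_pow_left₀ (Real.sqrt_nonneg _) hGγ 2
  have hG : gridSq G ≤ q := by rw [hq]; linarith [sq_nonneg γ]
  have hGs : gridSq Gs ≤ q := by
    have : gridSq Gs ≤ 2 * gridSq G + 2 * gridSq (G - Gs) := by
      simp only [gridSq, Finset.mul_sum, ← Finset.sum_add_distrib]
      refine Finset.sum_le_sum fun i _ => Finset.sum_le_sum fun j _ => ?_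
      have h := norm_sub_le (G i j) ((G - Gs) i j)
      rw [Pi.sub_apply, Pi.sub_apply, sub_sub_cancel] at h
      simp only [Pi.sub_apply]
      linarith [pow_le_pow_left₀ (norm_nonneg _) h 2, sq_nonneg (‖G i j‖ - ‖G i j - Gs i j‖)]
    rw [hq]; linarith [pow_le_one₀ (n := 2) hδ.le hδ1.le]
  have hFFi : ∫ t in Ioc B (B + ρ), gridSq (fun i j => (F - Fs) i j t) ≤ δ ^ 2 :=
    ((hF.sub hFs).integral_gridSq_le_normH1_sq hρ.le).trans
      (pow_le_pow_left₀ normH1_nonneg hFF.le 2)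
  have hWsA : AdmissibleFun a b B ρ c₀ D Ws := hD ▸ admissibleFun_of_mem_setK hρ.le hR hWs
  have hWA : AdmissibleFun a b B ρ c₀ D Wmin := hD ▸ admissibleFun_of_mem_closureH1 hρ.le hR hWmin
  obtain ⟨V, hV⟩ : ∃ V, V = glue B F Ws := ⟨_, rfl⟩
  have hVm : MemH1 B ρ V := hV ▸ memH1_glue hF hWs.1
  have hVsub := hVm.sub hWs.1
  have hVi : ∫ t in Ioc B (B + ρ), gridSq (fun i j => (V - Ws) i j t) ≤ δ ^ 2 :=
    (setIntegral_mono_on hVsub.integrable_gridSq (hF.sub hFs).integrable_gridSq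
      measurableSet_Ioc fun t ht =>
        hV ▸ gridSq_glue_sub_le hWs.2.2.1 hFsG (Ioc_subset_Icc_self ht)).trans hFFi
  have sqrt_bound : ∀ {W : SemiFun k N} {c : ℝ}, 0 ≤ c → MemH1 B ρ W →
      ∫ t in Ioc B (B + ρ), gridSq (fun i j => W i j t) ≤ c * δ ^ 2 →
      normH1 B ρ W ≤ √(normBound k * c) * δ := by
    intro W c hc hW hi
    refine abs_le_of_sq_le_sq' ((hW.normH1_sq_le hρ.le).trans ?_) (by positivity) |>.2
    rw [mul_pow, Real.sq_sqrt (by positivity), mul_assoc]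
    exact mul_le_mul_of_nonneg_left hi hnb.le
  have hVn : normH1 B ρ (V - Ws) ≤ √(normBound k) * δ := by
    have := sqrt_bound zero_le_one hVsub (by rwa [one_mul])
    rwa [mul_one] at this
  have hs1 : 0 < √(normBound k) := Real.sqrt_pos.2 hnb
  have hs2 : 0 ≤ √(normBound k * C₁) := Real.sqrt_nonneg _
  have hVR : normH1 B ρ V < R := by
    have := normH1_add_le hρ.le hWs.1 hVsub (sub_pos.2 hκR) (by positivity) hWsκ.le hVn
    rw [add_sub_cancel] at this
    linarith [mul_nonneg hs2 hδ.le]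
  -- A nonempty closure supplies an element of the constraint set, which certifies the lower bound
  -- on the boundary.
  obtain ⟨X, hX, -⟩ := hWmin.2 1 one_pos
  have hVK : V ∈ setK a b B ρ c₀ Gt R := hV ▸ glue_mem_setK hF hFG hWs hX (hV ▸ hVR)
  have hVA : AdmissibleFun a b B ρ c₀ D V := hD ▸ admissibleFun_of_mem_setK hρ.le hR hVK
  have hVres : ∀ i j, ∀ z ∈ Ioo B (B + ρ),
      ‖residual s a b B ρ G V i j z‖ ^ 2 ≤ N * (L * 2) * δ ^ 2 := by
    intro i j z hz
    have e1 := residual_sub_residual s a b B ρ G Gs V Ws i j z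
    have e2 : V (mid i) (mid j) z = Ws (mid i) (mid j) z := by
      rw [hV, glue, if_neg]
      rintro (h | h | h)
      · exact not_isEnd_mid i h
      · exact not_isEnd_mid j h
      · exact hz.1.ne' h
    -- The competitor agrees with `Ws` at interior nodes for `z > B`, so the local term `M_N` drops
    -- out. The change of values at lateral nodes enters only through the central differences in
    -- `P`.
    have e3 : (WithLp.toLp 2 (fun n => ∑ m : Fin N, matM a b N n m *
        (V (mid i) (mid j) z - Ws (mid i) (mid j) z) m) : EuclideanSpace ℝ (Fin N)) = 0 := by
      ext n; simp [e2]
    rw [hres i j z hz, sub_zero, e3, zero_add] at e1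
    rw [e1]
    have hmono : ∫ t in Ioc z (B + ρ), gridSq (fun i j => (V - Ws) i j t) ≤ δ ^ 2 :=
      (setIntegral_mono_set hVsub.integrable_gridSq
        (Filter.Eventually.of_forall fun t => gridSq_nonneg _)
        (Ioc_subset_Ioc_left hz.1.le).eventuallyLE).trans hVi
    refine (norm_toLp_sq_le fun n => (hLip G Gs V Ws hVA hWsA hG hGs z
      (Ioo_subset_Icc_self hz) n i j).trans
      (mul_le_mul_of_nonneg_left (add_le_add hmono hGG) hL)).trans (le_of_eq ?_)
    ring
  have hJ : costJ s a b B ρ lam G Wmin ≤ e₀ * δ ^ 2 := by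
    refine (hmin (subset_closureH1 (fun V hV => hV.1) hVK)).trans
      ((costJ_le hρ.le hlam hVres).trans (le_of_eq ?_))
    rw [he₀]; ring
  have hbd : ∀ i j, IsEnd i ∨ IsEnd j → ∀ᵐ t ∂volume.restrict (Ioc B (B + ρ)),
      (Wmin - Ws) i j t = (F - Fs) i j t := by
    intro i j hij
    filter_upwards [ae_eq_of_mem_closureH1 hρ.le hF hFG hWmin hij,
      ae_restrict_mem measurableSet_Ioc] with t ht htm
    have hor : IsEnd i ∨ IsEnd j ∨ t = B := hij.imp_right Or.inl
    simp only [Pi.sub_apply]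
    rw [ht, hWs.2.2.1 i j t (Ioc_subset_Icc_self htm) hor,
      hFsG i j t (Ioc_subset_Icc_self htm) hor]
  have hfin := hstab G Gs Wmin Ws (F - Fs) δ hWA hWsA (hF.sub hFs) hG hGs hres hGG hbd hFFi
    ((integral_gridSq_residual_le_costJ hs hab hB hρ hc₀ hlam G hWA).trans hJ)
  have := sqrt_bound hC₁.le (hWA.memH1.sub hWs.1) hfin
  linarith [mul_nonneg hs1.le hδ.le]
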